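/- **Setting.** Let $P$ be a right LCM semigroup, i.e. a left cancellative monoid in which, for all $p,q$, the set $pP\cap qP$ is either empty or of the form $rP$. If $r\in qP$, write $q^{-1}r$ for the unique $u\in P$ with $qu=r$. A *$C^*$-precategory* with object set $P$ consists of complex Banach spaces $\mathcal L(p,q)$, $p,q\in P$, with an associative bilinear composition $\mathcal L(p,q)\times\mathcal L(q,r)\to\mathcal L(p,r)$ and a conjugate linear involution $\mathcal L(p,q)\to\mathcal L(q,p)$, $a\mapsto a^*$, with $(ab)^*=b^*a^*$, such that $\|ab\|\le\|a\|\|b\|$, $\|a^*a\|=\|a\|^2$, and for each $a\in\mathcal L(p,q)$ there is $b\in\mathcal L(q,q)$ with $a^*a=b^*b$ (identity morphisms are not required). It is a *right-tensor $C^*$-precategory over $P$* if it carries linear maps $\mathcal L(p,q)\to\mathcal L(pr,qr)$, $a\mapsto a\otimes 1_r$ $(r\in P)$, compatible with composition and involution, with $a\otimes 1_e=a$ and $(a\otimes 1_r)\otimes 1_s=a\otimes 1_{rs}$. An *ideal* $\mathcal K$ in $\mathcal L$ is a family of closed subspaces $\mathcal K(p,q)\subseteq\mathcal L(p,q)$ absorbing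 composition with $\mathcal L$ on both sides; it is *well-aligned* if, whenever $pP\cap qP=rP$, one has $(a\otimes 1_{p^{-1}r})(b\otimes 1_{q^{-1}r})\in\mathcal K(r,r)$ for all $a\in\mathcal K(p,p)$, $b\in\mathcal K(q,q)$. A *representation* $\Phi:\mathcal K\to B$ in a $C^*$-algebra $B$ is a family of linear maps $\mathcal K(p,q)\to B$, all written $\Phi$, with $\Phi(a^*)=\Phi(a)^*$ and $\Phi(ab)=\Phi(a)\Phi(b)$ for composable $a,b$; $C^*(\Phi(\mathcal K))$ is the $C^*$-subalgebra of $B$ generated by the ranges. It is *Nica covariant* if for all $a\in\mathcal K(p,q)$, $b\in\mathcal K(s,t)$ $$\Phi(a)\Phi(b)=\begin{cases}\Phi\big((a\otimes 1_{q^{-1}r})(b\otimes 1_{s^{-1}r})\big)&\text{if } qP\cap sP=rP \text{ for some } r\in P,\\ 0&\text{otherwise},\end{cases}$$ where in the first case the identity is required for every such $r$. Let $i_{\mathcal K}:\mathcal K\to\mathcal{NT}_{\mathcal L}(\mathcal K)$ be the universal Nica covariant representation, with $\mathcal{NT}_{\mathcal L}(\mathcal K)$ generated by its range, and let $\Phi\rtimes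 P:\mathcal{NT}_{\mathcal L}(\mathcal K)\to C^*(\Phi(\mathcal K))$ be the homomorphism with $(\Phi\rtimes P)\circ i_{\mathcal K}=\Phi$. Let $X_{s,t}=\mathcal K(s,t)$, a right Hilbert $\mathcal K(t,t)$-module with $\langle x,y\rangle=x^*y$, and let $\mathcal F_{\mathcal K}=\bigoplus_{s,t\in P}X_{s,t}$ be the Hilbert module direct sum over the $C^*$-algebra $\bigoplus_{t}\mathcal K(t,t)$; $\mathcal L(\mathcal F_{\mathcal K})$ denotes its adjointable operators. For $a\in\mathcal K(p,q)$, $w\in qP$, $t\in P$ let $T^{w,t}_{p,q}(a):X_{w,t}\to X_{pq^{-1}w,t}$, $x\mapsto(a\otimes 1_{q^{-1}w})x$. The *Fock representation* $T:\mathcal K\to\mathcal L(\mathcal F_{\mathcal K})$, where $T(a)$ acts as $T^{w,t}_{p,q}(a)$ on $X_{w,t}$ if $w\in qP$ and as $0$ if $w\notin qP$, is Nica covariant; $\mathcal{NT}^r_{\mathcal L}(\mathcal K)=C^*(T(\mathcal K))$, and $T\rtimes P$ is the corresponding regular representation. Put $$B_{\mathcal K}=\overline{\operatorname{span}}\Big\{\bigoplus_{\substack{w\in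 pP\cap qP,\ t\in P\\ p^{-1}w=q^{-1}w}}T^{w,t}_{p,q}(a)\ :\ a\in\mathcal K(p,q),\ p,q\in P\Big\}\subseteq\mathcal L(\mathcal F_{\mathcal K}),$$ and let $E^T:\mathcal{NT}^r_{\mathcal L}(\mathcal K)\to B_{\mathcal K}$ be $E^T(S)=\sum_{w\in P}Q_wSQ_w$ (strong sum), where $Q_w$ is the projection of $\mathcal F_{\mathcal K}$ onto $\bigoplus_{t}X_{w,t}$. A Nica covariant representation $\Phi$ *generates an exotic Nica–Toeplitz $C^*$-algebra* if $\ker(\Phi\rtimes P)\subseteq\ker(T\rtimes P)$. **Proposition.** Let $\mathcal K$ be a well-aligned ideal in a right-tensor $C^*$-precategory $\mathcal L$ over a right LCM semigroup $P$, and let $\Phi:\mathcal K\to B$ be a Nica covariant representation. The following are equivalent: (i) $\Phi$ generates an exotic Nica–Toeplitz $C^*$-algebra; (ii) there is a bounded linear map $E^\Phi:C^*(\Phi(\mathcal K))\to B_{\mathcal K}$ such that $$E^\Phi\Big(\sum_{p,q\in F}\Phi(a_{p,q})\Big)=\sum_{p,q\in F}\ \bigoplus_{\substack{w\in pP\cap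 qP,\ t\in P\\ p^{-1}w=q^{-1}w}}T^{w,t}_{p,q}(a_{p,q})$$ for every finite $F\subseteq P$ and all $a_{p,q}\in\mathcal K(p,q)$, $p,q\in F$. If (i) and (ii) hold, then there is a unique $*$-homomorphism $\Phi_*:C^*(\Phi(\mathcal K))\to\mathcal{NT}^r_{\mathcal L}(\mathcal K)$ with $\Phi_*\circ(\Phi\rtimes P)=T\rtimes P$; the map $E^\Phi$ is contractive and completely positive; $E^\Phi=E^T\circ\Phi_*$; and $\Phi_*$ is an isomorphism if and only if $E^\Phi$ is faithful, i.e. $E^\Phi(c^*c)=0$ implies $c=0$ for $c\in C^*(\Phi(\mathcal K))$. -/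

import Mathlib

universe u v

noncomputable section

namespace NicaToeplitz

open scoped ENNReal

section Adjointable

variable (A E : Type*) [NonUnitalCStarAlgebra A] [PartialOrder A] [StarOrderedRing A]
  [NormedAddCommGroup E] [NormedSpace ℂ E] [SMul A E] [CStarModule A E]

theorem inner_left_ext {x y : E} (h : ∀ z : E, inner A x z = inner A y z) : x = y := by
  have : inner A (x - y) (x - y) = 0 := by
    rw [CStarModule.inner_sub_left, h, sub_self]
  exact sub_eq_zero.1 (CStarModule.inner_self.1 this)

theorem inner_right_ext {x y : E} (h : ∀ z : E, inner A z x = inner A z y) : x = y :=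
  inner_left_ext A E fun z => by
    rw [← CStarModule.star_inner, h z, CStarModule.star_inner]

/-- The algebra `𝓛(E)` of adjointable operators on the Hilbert module `E`. -/
def adjointableSubalgebra : Subalgebra ℂ (E →L[ℂ] E) where
  carrier := {S | ∃ S' : E →L[ℂ] E, ∀ x y, inner A (S x) y = inner A x (S' y)}
  mul_mem' := by
    rintro S R ⟨S', hS⟩ ⟨R', hR⟩
    exact ⟨R' * S', fun x y => by simp [hS, hR]⟩
  add_mem' := by
    rintro S R ⟨S', hS⟩ ⟨R', hR⟩
    exact ⟨S' + R', fun x y => by simp [hS, hR]⟩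
  algebraMap_mem' c := ⟨algebraMap ℂ _ (star c), fun x y => by
    simp [Algebra.algebraMap_eq_smul_one]⟩

/-- The type of adjointable operators on the Hilbert module `E`, with the operator norm. -/
def Adjointable : Type _ := ↥(adjointableSubalgebra A E)

variable {A E}

namespace Adjointable

instance : NormedRing (Adjointable A E) :=
  inferInstanceAs (NormedRing ↥(adjointableSubalgebra A E))

instance : NormedAlgebra ℂ (Adjointable A E) :=
  inferInstanceAs (NormedAlgebra ℂ ↥(adjointableSubalgebra A E))

theorem ext' {S R : Adjointable A E} (h : ∀ x, S.1 x = R.1 x) : S = R :=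
  Subtype.ext (ContinuousLinearMap.ext h)

theorem norm_apply_le (S : Adjointable A E) (x : E) : ‖S.1 x‖ ≤ ‖S‖ * ‖x‖ := S.1.le_opNorm x

theorem exists_adj (S : Adjointable A E) :
    ∃ R : Adjointable A E, ∀ x y, inner A (S.1 x) y = inner A x (R.1 y) := by
  obtain ⟨S', h⟩ := S.2
  refine ⟨⟨S', S.1, fun x y => ?_⟩, h⟩
  rw [← CStarModule.star_inner, ← h, CStarModule.star_inner]

instance : Star (Adjointable A E) := ⟨fun S => (exists_adj S).choose⟩

theorem inner_apply_left (S : Adjointable A E) (x y : E) :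
    inner A (S.1 x) y = inner A x ((star S).1 y) := (exists_adj S).choose_spec x y

theorem inner_apply_right (S : Adjointable A E) (x y : E) :
    inner A x (S.1 y) = inner A ((star S).1 x) y := by
  rw [← CStarModule.star_inner, inner_apply_left, CStarModule.star_inner]

theorem star_unique {S R : Adjointable A E}
    (h : ∀ x y, inner A (S.1 x) y = inner A x (R.1 y)) : star S = R :=
  ext' fun y => inner_right_ext A E fun x => by rw [← inner_apply_left, h]

instance : StarRing (Adjointable A E) where
  star_involutive S := star_unique fun x y => by rw [inner_apply_right]
  star_mul S R := star_unique fun x y => by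
    change inner A (S.1 (R.1 x)) y = inner A x ((star R).1 ((star S).1 y))
    rw [inner_apply_left, inner_apply_left]
  star_add S R := star_unique fun x y => by
    change inner A (S.1 x + R.1 x) y = inner A x ((star S).1 y + (star R).1 y)
    simp [inner_apply_left]

instance : StarModule ℂ (Adjointable A E) where
  star_smul c S := star_unique fun x y => by
    change inner A (c • S.1 x) y = inner A x (star c • (star S).1 y)
    simp [inner_apply_left]

theorem norm_apply_sq_le (S : Adjointable A E) (x : E) :
    ‖S.1 x‖ ^ 2 ≤ ‖star S * S‖ * ‖x‖ ^ 2 := by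
  rw [CStarModule.norm_sq_eq A, inner_apply_left]
  calc _ ≤ ‖x‖ * ‖(star S).1 (S.1 x)‖ := CStarModule.norm_inner_le E
    _ ≤ ‖x‖ * (‖star S * S‖ * ‖x‖) := by
      gcongr; exact norm_apply_le (star S * S) x
    _ = _ := by ring

instance : CStarRing (Adjointable A E) where
  norm_mul_self_le S := by
    have h : ‖S‖ ≤ √‖star S * S‖ := by
      refine ContinuousLinearMap.opNorm_le_bound _ (by positivity) fun x => ?_
      have := Real.sqrt_le_sqrt (norm_apply_sq_le S x)
      rwa [Real.sqrt_mul (norm_nonneg _), Real.sqrt_sq (norm_nonneg _),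
        Real.sqrt_sq (norm_nonneg _)] at this
    calc ‖S‖ * ‖S‖ ≤ √‖star S * S‖ * √‖star S * S‖ := by gcongr
      _ = _ := Real.mul_self_sqrt (norm_nonneg _)

instance [CompleteSpace E] : CompleteSpace (Adjointable A E) := by
  have hc : IsClosed ((adjointableSubalgebra A E : Subalgebra ℂ (E →L[ℂ] E)) :
      Set (E →L[ℂ] E)) := by
    refine isClosed_of_closure_subset fun S hS => ?_
    obtain ⟨u, hu, hlim⟩ := mem_closure_iff_seq_limit.1 hS
    let v : ℕ → Adjointable A E := fun n => ⟨u n, hu n⟩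
    have hv : CauchySeq v := by
      have := hlim.cauchySeq
      rw [Metric.cauchySeq_iff] at this ⊢
      exact this
    have hw : CauchySeq fun n => ((star (v n)).1 : E →L[ℂ] E) := by
      rw [Metric.cauchySeq_iff] at hv ⊢
      intro ε hε
      obtain ⟨N, hN⟩ := hv ε hε
      refine ⟨N, fun m hm n hn => ?_⟩
      have h1 : dist (star (v m)) (star (v n)) = dist (v m) (v n) := by
        rw [dist_eq_norm, dist_eq_norm, ← star_sub (R := Adjointable A E), norm_star]
      exact h1 ▸ hN m hm n hn
    obtain ⟨R, hR⟩ := cauchySeq_tendsto_of_complete hw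
    refine ⟨R, fun x y => ?_⟩
    have h1 : Filter.Tendsto (fun n => inner A ((u n) x) y) Filter.atTop
        (nhds (inner A (S x) y)) := by
      have hx : Filter.Tendsto (fun n => (u n) x) Filter.atTop (nhds (S x)) :=
        ((ContinuousLinearMap.apply ℂ E x).continuous.tendsto S).comp hlim
      exact (CStarModule.continuous_inner.tendsto (S x, y)).comp
        (hx.prodMk_nhds tendsto_const_nhds)
    have h2 : Filter.Tendsto (fun n => inner A x ((star (v n)).1 y)) Filter.atTop
        (nhds (inner A x (R y))) := by
      have hx : Filter.Tendsto (fun n => (star (v n)).1 y) Filter.atTop (nhds (R y)) :=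
        ((ContinuousLinearMap.apply ℂ E y).continuous.tendsto R).comp hR
      exact (CStarModule.continuous_inner.tendsto (x, R y)).comp
        (tendsto_const_nhds.prodMk_nhds hx)
    refine tendsto_nhds_unique h1 (h2.congr fun n => ?_)
    exact (inner_apply_left (v n) x y).symm
  exact hc.completeSpace_coe

instance [CompleteSpace E] : CStarAlgebra (Adjointable A E) where

/-- A pair of mutually adjoint maps on a Hilbert module defines an adjointable operator:
linearity and boundedness are automatic. -/
def ofPair [CompleteSpace E] (f g : E → E) (h : ∀ x y, inner A (f x) y = inner A x (g y)) :
    Adjointable A E :=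
  have key : ∀ (f g : E → E), (∀ x y, inner A (f x) y = inner A x (g y)) →
      ∃ S : E →L[ℂ] E, ∀ x, S x = f x := by
    intro f g h
    let F : E →ₗ[ℂ] E :=
      { toFun := f
        map_add' := fun x y => inner_left_ext A E fun z => by simp [h]
        map_smul' := fun c x => inner_left_ext A E fun z => by simp [h] }
    have hF : Continuous F := by
      refine F.continuous_of_seq_closed_graph fun u x y hu hy => ?_
      refine inner_left_ext A E fun z => ?_
      have h1 : Filter.Tendsto (fun n => inner A (f (u n)) z) Filter.atTop
          (nhds (inner A y z)) :=
        (CStarModule.continuous_inner.tendsto (y, z)).comp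
          (hy.prodMk_nhds tendsto_const_nhds)
      have h2 : Filter.Tendsto (fun n => inner A (u n) (g z)) Filter.atTop
          (nhds (inner A x (g z))) :=
        (CStarModule.continuous_inner.tendsto (x, g z)).comp
          (hu.prodMk_nhds tendsto_const_nhds)
      simp_rw [h] at h1
      exact (tendsto_nhds_unique h1 h2).trans (h x z).symm
    exact ⟨⟨F, hF⟩, fun x => rfl⟩
  have hg : ∀ x y, inner A (g x) y = inner A x (f y) := fun x y => by
    rw [← CStarModule.star_inner, ← h, CStarModule.star_inner]
  ⟨⟨{ toFun := f
      map_add' := fun x y => inner_left_ext A E fun z => by simp [h]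
      map_smul' := fun c x => inner_left_ext A E fun z => by simp [h] }, by
      obtain ⟨S, hS⟩ := key f g h
      exact S.continuous.congr hS⟩, by
    obtain ⟨S, hS⟩ := key g f hg
    exact ⟨S, fun x y => by rw [hS]; exact h x y⟩⟩

@[simp] theorem ofPair_apply [CompleteSpace E] (f g : E → E)
    (h : ∀ x y, inner A (f x) y = inner A x (g y)) (x : E) : (ofPair f g h).1 x = f x := rfl

theorem star_ofPair [CompleteSpace E] (f g : E → E)
    (h : ∀ x y, inner A (f x) y = inner A x (g y)) (h' : ∀ x y, inner A (g x) y = inner A x (f y)) :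
    star (ofPair f g h) = ofPair g f h' := star_unique h

/-- `⟪x, S x⟫ ≤ ‖S‖ ⟪x, x⟫` for a self-adjoint operator `S`. -/
theorem inner_le_of_isSelfAdjoint [CompleteSpace E] (S : Adjointable A E) (hS : IsSelfAdjoint S)
    (x : E) : inner A x (S.1 x) ≤ ‖S‖ • inner A x x := by
  let _ := CStarAlgebra.spectralOrder (Adjointable A E)
  have := CStarAlgebra.spectralOrderedRing (Adjointable A E)
  have h := sub_nonneg.2 hS.le_algebraMap_norm_self
  obtain ⟨R, hR⟩ := CStarAlgebra.nonneg_iff_eq_star_mul_self.1 h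
  have h1 : inner A x ((star R * R).1 x) = inner A (R.1 x) (R.1 x) :=
    (inner_apply_left R x (R.1 x)).symm
  rw [← hR, Algebra.algebraMap_eq_smul_one] at h1
  change inner A x (‖S‖ • x - S.1 x) = _ at h1
  have h2 : (0 : A) ≤ inner A x (‖S‖ • x - S.1 x) := h1 ▸ CStarModule.inner_self_nonneg
  rw [CStarModule.inner_sub_right, CStarModule.inner_smul_right_real] at h2
  exact sub_nonneg.1 h2

theorem inner_apply_self_le [CompleteSpace E] (S : Adjointable A E) (x : E) :
    inner A (S.1 x) (S.1 x) ≤ ‖S‖ ^ 2 • inner A x x := by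
  have := inner_le_of_isSelfAdjoint (star S * S) (IsSelfAdjoint.star_mul_self S) x
  rw [CStarRing.norm_star_mul_self, ← pow_two] at this
  rwa [inner_apply_left]

end Adjointable

end Adjointable

section HilbertSum

variable (A : Type*) [NonUnitalCStarAlgebra A] [PartialOrder A] [StarOrderedRing A]
  {ι : Type*} (E : ι → Type*) [∀ i, NormedAddCommGroup (E i)] [∀ i, NormedSpace ℂ (E i)]
  [∀ i, SMul A (E i)] [∀ i, CStarModule A (E i)]

theorem inner_cauchySchwarz_sum (J : Finset ι) (x y : ∀ i, E i) :
    ‖∑ i ∈ J, inner A (x i) (y i)‖ ≤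
      √‖∑ i ∈ J, inner A (x i) (x i)‖ * √‖∑ i ∈ J, inner A (y i) (y i)‖ := by
  have h := CStarModule.norm_inner_le (A := A) (WithCStarModule A ((i : J) → E i))
    (x := (WithCStarModule.equiv A _).symm fun i : J => x i)
    (y := (WithCStarModule.equiv A _).symm fun i : J => y i)
  rw [CStarModule.norm_eq_sqrt_norm_inner_self (A := A)
      (E := WithCStarModule A ((i : J) → E i)),
    CStarModule.norm_eq_sqrt_norm_inner_self (A := A)
      (E := WithCStarModule A ((i : J) → E i))] at h
  simp only [WithCStarModule.pi_inner] at h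
  rw [← Finset.sum_coe_sort J, ← Finset.sum_coe_sort J, ← Finset.sum_coe_sort J]
  exact h

variable {A E} in
theorem summable_inner {x y : ∀ i, E i} (hx : Summable fun i => inner A (x i) (x i))
    (hy : Summable fun i => inner A (y i) (y i)) : Summable fun i => inner A (x i) (y i) := by
  rw [summable_iff_vanishing_norm] at *
  intro ε hε
  obtain ⟨s, hs⟩ := hx ε hε
  obtain ⟨t, ht⟩ := hy ε hε
  classical
  refine ⟨s ∪ t, fun J hJ => ?_⟩
  rw [Finset.disjoint_union_right] at hJ
  calc _ ≤ _ := inner_cauchySchwarz_sum A E J x y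
    _ ≤ √ε * √‖∑ i ∈ J, inner A (y i) (y i)‖ := by
      gcongr; exact (hs J hJ.1).le
    _ < √ε * √ε := by
      gcongr
      exact ht J hJ.2
    _ = ε := Real.mul_self_sqrt hε.le

/-- The families `(x i)` for which `∑ ⟪x i, x i⟫` converges unconditionally in norm. -/
def hilbertSumSubmodule : Submodule ℂ (∀ i, E i) where
  carrier := {x | Summable fun i => inner A (x i) (x i)}
  add_mem' := by
    intro x y hx hy
    have h := ((hx.add (summable_inner hx hy)).add (summable_inner hy hx)).add hy
    refine h.congr fun i => ?_
    simp only [Pi.add_apply, CStarModule.inner_add_left, CStarModule.inner_add_right]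
    abel
  zero_mem' := by
    change Summable fun i => inner A ((0 : ∀ i, E i) i) ((0 : ∀ i, E i) i)
    simp
  smul_mem' := by
    intro c x hx
    refine ((Summable.const_smul (star c) hx).const_smul c).congr fun i => ?_
    simp

/-- The direct sum `⨁ E i` of Hilbert modules over `A`. -/
def HilbertSum : Type _ := ↥(hilbertSumSubmodule A E)

namespace HilbertSum

variable {A E}

instance : AddCommGroup (HilbertSum A E) :=
  inferInstanceAs (AddCommGroup ↥(hilbertSumSubmodule A E))

instance : Module ℂ (HilbertSum A E) :=
  inferInstanceAs (Module ℂ ↥(hilbertSumSubmodule A E))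

theorem summable (x y : HilbertSum A E) : Summable fun i => inner A (x.1 i) (y.1 i) :=
  summable_inner x.2 y.2

instance : SMul A (HilbertSum A E) where
  smul a x := ⟨fun i => a • x.1 i, by
    change Summable fun i => inner A (a • x.1 i) (a • x.1 i)
    refine ((x.summable x).mul_left a |>.mul_right (star a)).congr fun i => ?_
    simp [mul_assoc]⟩

instance : Norm (HilbertSum A E) where
  norm x := √‖∑' i, inner A (x.1 i) (x.1 i)‖

instance : CStarModule A (HilbertSum A E) where
  inner x y := ∑' i, inner A (x.1 i) (y.1 i)
  inner_add_right {x y z} := by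
    rw [← (x.summable y).tsum_add (x.summable z)]
    refine tsum_congr fun i => ?_
    exact CStarModule.inner_add_right
  inner_self_nonneg {x} := by
    have : IsClosed {a : A | 0 ≤ a} := CStarAlgebra.isClosed_nonneg
    refine this.mem_of_tendsto (x.summable x).hasSum (Filter.Eventually.of_forall fun s => ?_)
    exact Finset.sum_nonneg fun i _ => CStarModule.inner_self_nonneg
  inner_self {x} := by
    constructor
    · intro h
      refine Subtype.ext (funext fun i => ?_)
      have hcl : IsClosed {a : A | inner A (x.1 i) (x.1 i) ≤ a} := by
        have h0 : IsClosed {a : A | 0 ≤ a} := CStarAlgebra.isClosed_nonneg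
        have : {a : A | inner A (x.1 i) (x.1 i) ≤ a} =
            (fun a => a - inner A (x.1 i) (x.1 i)) ⁻¹' {a : A | 0 ≤ a} := by
          ext a; simp
        rw [this]
        exact h0.preimage (by fun_prop)
      have h1 : inner A (x.1 i) (x.1 i) ≤ ∑' i, inner A (x.1 i) (x.1 i) := by
        refine hcl.mem_of_tendsto (x.summable x).hasSum
          ((Filter.eventually_ge_atTop {i}).mono fun s hs => ?_)
        exact Finset.single_le_sum (f := fun i => inner A (x.1 i) (x.1 i))
          (fun i _ => CStarModule.inner_self_nonneg) (by simpa using hs)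
      rw [h] at h1
      exact CStarModule.inner_self.1 (le_antisymm h1 CStarModule.inner_self_nonneg)
    · rintro rfl
      change ∑' i, inner A (0 : E i) (0 : E i) = 0
      simp
  inner_op_smul_right {a x y} := by
    rw [← (x.summable y).tsum_mul_left]
    exact tsum_congr fun i => CStarModule.inner_op_smul_right
  inner_smul_right_complex {z x y} := by
    rw [← (x.summable y).tsum_const_smul]
    exact tsum_congr fun i => CStarModule.inner_smul_right_complex
  star_inner x y := by
    rw [tsum_star]
    exact tsum_congr fun i => CStarModule.star_inner _ _
  norm_eq_sqrt_norm_inner_self x := rfl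

instance : NormedAddCommGroup (HilbertSum A E) := CStarModule.normedAddCommGroup A

instance : NormedSpace ℂ (HilbertSum A E) := .ofCore (CStarModule.normedSpaceCore A)

theorem inner_def (x y : HilbertSum A E) : inner A x y = ∑' i, inner A (x.1 i) (y.1 i) := rfl

/-- The truncation of a family to a set of indices. -/
def cut (J : Set ι) (x : HilbertSum A E) : HilbertSum A E := by
  classical
  exact ⟨fun i => if i ∈ J then x.1 i else 0, by
    change Summable fun i => inner A (if i ∈ J then x.1 i else 0) (if i ∈ J then x.1 i else 0)
    refine ((x.summable x).indicator J).congr fun i => ?_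
    by_cases h : i ∈ J <;> simp [h]⟩

theorem cut_apply_mem {J : Set ι} (x : HilbertSum A E) {i : ι} (h : i ∈ J) :
    (cut J x).1 i = x.1 i := if_pos h

theorem cut_apply_notMem {J : Set ι} (x : HilbertSum A E) {i : ι} (h : i ∉ J) :
    (cut J x).1 i = 0 := if_neg h

theorem inner_cut_left (J : Set ι) (x y : HilbertSum A E) :
    inner A (cut J x) y = inner A x (cut J y) := by
  refine tsum_congr fun i => ?_
  by_cases h : i ∈ J
  · rw [cut_apply_mem x h, cut_apply_mem y h]
  · rw [cut_apply_notMem x h, cut_apply_notMem y h]; simp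

/-- Every family restricted to finitely many indices lies in the direct sum. -/
def ofFinset (J : Finset ι) (x : ∀ i, E i) : HilbertSum A E := by
  classical
  exact ⟨fun i => if i ∈ J then x i else 0, by
    change Summable fun i => inner A (if i ∈ J then x i else 0) (if i ∈ J then x i else 0)
    refine summable_of_ne_finset_zero (s := J) fun i hi => by simp [hi]⟩

theorem norm_sq_ofFinset (J : Finset ι) (x : ∀ i, E i) :
    ‖(ofFinset J x : HilbertSum A E)‖ ^ 2 = ‖∑ i ∈ J, inner A (x i) (x i)‖ := by
  classical
  rw [CStarModule.norm_sq_eq A, inner_def, tsum_eq_sum (s := J)]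
  · congr 1
    refine Finset.sum_congr rfl fun i hi => ?_
    change inner A (if i ∈ J then x i else 0) (if i ∈ J then x i else 0) = _
    rw [if_pos hi]
  · intro i hi
    change inner A (if i ∈ J then x i else 0) (if i ∈ J then x i else 0) = _
    simp [hi]

theorem norm_sum_inner_le (J : Finset ι) (x : HilbertSum A E) :
    ‖∑ i ∈ J, inner A (x.1 i) (x.1 i)‖ ≤ ‖x‖ ^ 2 := by
  classical
  have h1 : inner A (ofFinset J x.1 : HilbertSum A E) (ofFinset J x.1) =
      inner A (ofFinset J x.1 : HilbertSum A E) x := by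
    refine tsum_congr fun i => ?_
    change inner A (if i ∈ J then x.1 i else 0) (if i ∈ J then x.1 i else 0) =
      inner A (if i ∈ J then x.1 i else 0) (x.1 i)
    split_ifs <;> simp
  have h2 : ‖(ofFinset J x.1 : HilbertSum A E)‖ ^ 2 ≤
      ‖(ofFinset J x.1 : HilbertSum A E)‖ * ‖x‖ := by
    rw [CStarModule.norm_sq_eq A, h1]
    exact CStarModule.norm_inner_le _
  rw [← norm_sq_ofFinset]
  have h3 : ‖(ofFinset J x.1 : HilbertSum A E)‖ ≤ ‖x‖ := by
    by_contra! h
    have := norm_nonneg x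
    nlinarith
  gcongr

theorem norm_apply_le (x : HilbertSum A E) (i : ι) : ‖x.1 i‖ ≤ ‖x‖ := by
  have := norm_sum_inner_le {i} x
  rw [Finset.sum_singleton, ← CStarModule.norm_sq_eq A] at this
  exact (sq_le_sq₀ (norm_nonneg _) (norm_nonneg _)).1 this

instance [∀ i, CompleteSpace (E i)] : CompleteSpace (HilbertSum A E) := by
  refine Metric.complete_of_cauchySeq_tendsto fun u hu => ?_
  have hc : ∀ i, ∃ y, Filter.Tendsto (fun n => (u n).1 i) Filter.atTop (nhds y) := fun i => by
    refine cauchySeq_tendsto_of_complete ?_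
    rw [Metric.cauchySeq_iff] at hu ⊢
    intro ε hε
    obtain ⟨N, hN⟩ := hu ε hε
    refine ⟨N, fun m hm n hn => lt_of_le_of_lt ?_ (hN m hm n hn)⟩
    rw [dist_eq_norm, dist_eq_norm]
    exact norm_apply_le (u m - u n) i
  choose y hy using hc
  have key : ∀ ε > 0, ∃ N, ∀ n ≥ N, ∀ J : Finset ι,
      ‖∑ i ∈ J, inner A (y i - (u n).1 i) (y i - (u n).1 i)‖ ≤ ε ^ 2 := by
    intro ε hε
    obtain ⟨N, hN⟩ := Metric.cauchySeq_iff.1 hu ε hε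
    refine ⟨N, fun n hn J => ?_⟩
    have hlim : Filter.Tendsto
        (fun m => ‖∑ i ∈ J, inner A ((u m).1 i - (u n).1 i) ((u m).1 i - (u n).1 i)‖)
        Filter.atTop (nhds ‖∑ i ∈ J, inner A (y i - (u n).1 i) (y i - (u n).1 i)‖) := by
      refine (tendsto_finsetSum J fun i _ => ?_).norm
      have h1 := (hy i).sub_const ((u n).1 i)
      exact (CStarModule.continuous_inner.tendsto (y i - (u n).1 i, y i - (u n).1 i)).comp
        (h1.prodMk_nhds h1)
    refine le_of_tendsto hlim ((Filter.eventually_ge_atTop N).mono fun m hm => ?_)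
    refine (norm_sum_inner_le J (u m - u n)).trans ?_
    have := (hN m hm n hn).le
    rw [dist_eq_norm] at this
    gcongr
  have hsum : Summable fun i => inner A (y i) (y i) := by
    rw [summable_iff_vanishing_norm]
    intro ε hε
    have hδ : 0 < √ε / 4 := by positivity
    obtain ⟨N, hN⟩ := key _ hδ
    obtain ⟨s, hs⟩ := summable_iff_vanishing_norm.1 ((u N).summable (u N)) ((√ε / 4) ^ 2)
      (by positivity)
    refine ⟨s, fun J hJ => ?_⟩
    have h1 : ‖(ofFinset J y : HilbertSum A E)‖ ≤ √ε / 4 + √ε / 4 := by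
      have e : (ofFinset J y : HilbertSum A E) =
          ofFinset J (fun i => y i - (u N).1 i) + ofFinset J (u N).1 := by
        classical
        refine Subtype.ext (funext fun i => ?_)
        change (if i ∈ J then y i else 0) =
          (if i ∈ J then y i - (u N).1 i else 0) + (if i ∈ J then (u N).1 i else 0)
        split_ifs <;> simp
      rw [e]
      refine (norm_add_le _ _).trans (add_le_add ?_ ?_)
      · refine (sq_le_sq₀ (norm_nonneg _) hδ.le).1 ?_
        rw [norm_sq_ofFinset]
        exact hN N le_rfl J
      · refine (sq_le_sq₀ (norm_nonneg _) hδ.le).1 ?_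
        rw [norm_sq_ofFinset]
        exact (hs J hJ).le
    rw [← norm_sq_ofFinset]
    calc _ ≤ (√ε / 4 + √ε / 4) ^ 2 := by gcongr
      _ = (√ε) ^ 2 / 4 := by ring
      _ = ε / 4 := by rw [Real.sq_sqrt hε.le]
      _ < ε := by linarith
  have hmem : y ∈ hilbertSumSubmodule A E := hsum
  let w : HilbertSum A E := ⟨y, hmem⟩
  refine ⟨w, ?_⟩
  rw [Metric.tendsto_atTop]
  intro ε hε
  obtain ⟨N, hN⟩ := key (ε / 2) (by positivity)
  refine ⟨N, fun n hn => ?_⟩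
  rw [dist_comm, dist_eq_norm]
  set z : HilbertSum A E := w - u n with hz
  have h1 : ‖z‖ ^ 2 ≤ (ε / 2) ^ 2 := by
    rw [CStarModule.norm_sq_eq A]
    exact le_of_tendsto (z.summable z).hasSum.norm (Filter.Eventually.of_forall fun J => hN n hn J)
  have := (sq_le_sq₀ (norm_nonneg z) (by positivity)).1 h1
  linarith

variable [∀ i, CompleteSpace (E i)]

/-- The orthogonal projection of `⨁ E i` onto `⨁_{i ∈ J} E i`. -/
def proj (J : Set ι) : Adjointable A (HilbertSum A E) :=
  Adjointable.ofPair (cut J) (cut J) (inner_cut_left J)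

theorem cut_cut (J : Set ι) (x : HilbertSum A E) : cut J (cut J x) = cut J x := by
  refine Subtype.ext (funext fun i => ?_)
  by_cases h : i ∈ J
  · rw [cut_apply_mem _ h]
  · rw [cut_apply_notMem _ h, cut_apply_notMem _ h]

theorem inner_cut_cut_of_disjoint {J K : Set ι} (h : Disjoint J K) (x y : HilbertSum A E) :
    inner A (cut J x) (cut K y) = 0 := by
  rw [inner_def, ← tsum_zero (β := ι)]
  refine tsum_congr fun i => ?_
  by_cases hi : i ∈ J
  · rw [cut_apply_notMem y (Set.disjoint_left.1 h hi)]; simp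
  · rw [cut_apply_notMem x hi]; simp

theorem inner_cut_self_le (J : Set ι) (x : HilbertSum A E) :
    inner A (cut J x) (cut J x) ≤ inner A x x := by
  have h : inner A x x = inner A (cut J x) (cut J x) + inner A (x - cut J x) (x - cut J x) := by
    have h1 : inner A (cut J x) x = inner A (cut J x) (cut J x) := by
      rw [← inner_cut_left, cut_cut]
    have h2 : inner A x (cut J x) = inner A (cut J x) (cut J x) := by
      rw [inner_cut_left, cut_cut]
    simp only [CStarModule.inner_sub_left, CStarModule.inner_sub_right, h1, h2]
    abel
  rw [h]
  exact le_add_of_nonneg_right CStarModule.inner_self_nonneg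

variable {κ : Type*} (π : ι → κ)

theorem hasSum_inner_cut_fiber (x y : HilbertSum A E) :
    HasSum (fun k => inner A (cut (π ⁻¹' {k}) x) y) (inner A x y) := by
  have h : HasSum (fun p : (k : κ) × (π ⁻¹' {k} : Set ι) =>
      inner A (x.1 p.2) (y.1 p.2)) (inner A x y) :=
    (Equiv.sigmaFiberEquiv π).hasSum_iff.2 (x.summable y).hasSum
  refine h.sigma fun k => ?_
  have h2 := (((cut (π ⁻¹' {k}) x).summable y).hasSum)
  have h3 := (hasSum_subtype_iff_of_support_subset (f := fun i =>
    inner A ((cut (π ⁻¹' {k}) x).1 i) (y.1 i)) (s := π ⁻¹' {k}) (fun i hi => by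
      by_contra hn
      exact hi (by simp only [cut_apply_notMem x hn]; simp))).2 h2
  convert h3 using 2 with i
  · change _ = inner A ((cut (π ⁻¹' {k}) x).1 i) (y.1 i)
    rw [cut_apply_mem x i.2]
  · rfl

theorem inner_sum_cut_fiber (J : Finset κ) (y : κ → HilbertSum A E) :
    inner A (∑ k ∈ J, cut (π ⁻¹' {k}) (y k)) (∑ k ∈ J, cut (π ⁻¹' {k}) (y k)) =
      ∑ k ∈ J, inner A (cut (π ⁻¹' {k}) (y k)) (cut (π ⁻¹' {k}) (y k)) := by
  rw [CStarModule.inner_sum_left]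
  refine Finset.sum_congr rfl fun k hk => ?_
  rw [CStarModule.inner_sum_right]
  refine Finset.sum_eq_single k (fun l _ hl => ?_) (fun h => absurd hk h)
  refine inner_cut_cut_of_disjoint (Set.disjoint_left.2 fun i hi hi' => hl ?_) _ _
  exact hi'.symm.trans hi

/-- For an adjointable operator `S` the sum `∑ Q_k S Q_k x` over the fibres of `π` converges. -/
theorem summable_diagonal (S : Adjointable A (HilbertSum A E)) (x : HilbertSum A E) :
    Summable fun k => cut (π ⁻¹' {k}) (S.1 (cut (π ⁻¹' {k}) x)) := by
  have hs : Summable fun k => inner A (cut (π ⁻¹' {k}) x) (cut (π ⁻¹' {k}) x) := by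
    refine (hasSum_inner_cut_fiber π x x).summable.congr fun k => ?_
    rw [← inner_cut_left, cut_cut]
  rw [summable_iff_vanishing_norm] at hs ⊢
  intro ε hε
  obtain ⟨s, h⟩ := hs ((ε / (‖S‖ + 1)) ^ 2) (by positivity)
  refine ⟨s, fun J hJ => ?_⟩
  set z := ∑ k ∈ J, cut (π ⁻¹' {k}) (S.1 (cut (π ⁻¹' {k}) x)) with hz
  have h1 : ‖z‖ ^ 2 ≤ ‖S‖ ^ 2 *
      ‖∑ k ∈ J, inner A (cut (π ⁻¹' {k}) x) (cut (π ⁻¹' {k}) x)‖ := by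
    rw [CStarModule.norm_sq_eq A, hz, inner_sum_cut_fiber]
    have h2 : ∑ k ∈ J, inner A (cut (π ⁻¹' {k}) (S.1 (cut (π ⁻¹' {k}) x)))
        (cut (π ⁻¹' {k}) (S.1 (cut (π ⁻¹' {k}) x))) ≤
        ‖S‖ ^ 2 • ∑ k ∈ J, inner A (cut (π ⁻¹' {k}) x) (cut (π ⁻¹' {k}) x) := by
      rw [Finset.smul_sum]
      refine Finset.sum_le_sum fun k _ => ?_
      refine le_trans ?_ (Adjointable.inner_apply_self_le S _)
      exact inner_cut_self_le _ _
    refine (CStarAlgebra.norm_le_norm_of_nonneg_of_le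
      (Finset.sum_nonneg fun _ _ => CStarModule.inner_self_nonneg) h2).trans_eq ?_
    rw [norm_smul, Real.norm_of_nonneg (by positivity)]
  have h3 : ‖z‖ ^ 2 ≤ (‖S‖ * (ε / (‖S‖ + 1))) ^ 2 := by
    refine h1.trans ?_
    rw [mul_pow]
    gcongr
    exact (h J hJ).le
  have h4 := (sq_le_sq₀ (norm_nonneg z) (by positivity)).1 h3
  refine h4.trans_lt ?_
  rw [mul_div_assoc', div_lt_iff₀ (by positivity)]
  nlinarith [norm_nonneg S]

/-- The conditional expectation `S ↦ ∑ Q_k S Q_k` (strong sum) onto the operators commuting with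
all projections `Q_k` onto the fibres of `π`. -/
def diagonal (S : Adjointable A (HilbertSum A E)) : Adjointable A (HilbertSum A E) :=
  have key : ∀ (S : Adjointable A (HilbertSum A E)) (x y : HilbertSum A E),
      HasSum (fun k => inner A (cut (π ⁻¹' {k}) (S.1 (cut (π ⁻¹' {k}) x))) y)
        (inner A (∑' k, (proj (π ⁻¹' {k})).1 (S.1 ((proj (π ⁻¹' {k})).1 x))) y) :=
    fun S x y => by
      have h := (summable_diagonal π S x).hasSum
      exact h.map (AddMonoidHom.mk' (fun z : HilbertSum A E => inner A z y)
        fun a b => CStarModule.inner_add_left) (by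
          exact CStarModule.continuous_inner.comp (continuous_id.prodMk continuous_const))
  Adjointable.ofPair
    (fun x => ∑' k, (proj (π ⁻¹' {k})).1 (S.1 ((proj (π ⁻¹' {k})).1 x)))
    (fun x => ∑' k, (proj (π ⁻¹' {k})).1 ((star S).1 ((proj (π ⁻¹' {k})).1 x))) (by
      intro x y
      refine (key S x y).unique ?_
      have h := (key (star S) y x).star
      rw [CStarModule.star_inner] at h
      refine h.congr_fun fun k => ?_
      rw [CStarModule.star_inner, inner_cut_left, Adjointable.inner_apply_left, inner_cut_left])

end HilbertSum

end HilbertSum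

/-- A `C*`-precategory with set of objects `Ob`; `Hom σ ρ` is the space `𝓛(σ, ρ)` of morphisms
from `ρ` to `σ`. -/
structure CStarPrecategory (Ob : Type u) where
  Hom : Ob → Ob → Type v
  [normedAddCommGroup : ∀ σ ρ, NormedAddCommGroup (Hom σ ρ)]
  [normedSpace : ∀ σ ρ, NormedSpace ℂ (Hom σ ρ)]
  [completeSpace : ∀ σ ρ, CompleteSpace (Hom σ ρ)]
  comp : ∀ {τ σ ρ}, Hom τ σ → Hom σ ρ → Hom τ ρ
  adj : ∀ {σ ρ}, Hom σ ρ → Hom ρ σ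
  comp_assoc : ∀ {τ σ ρ π} (a : Hom τ σ) (b : Hom σ ρ) (c : Hom ρ π),
    comp (comp a b) c = comp a (comp b c)
  add_comp : ∀ {τ σ ρ} (a a' : Hom τ σ) (b : Hom σ ρ), comp (a + a') b = comp a b + comp a' b
  comp_add : ∀ {τ σ ρ} (a : Hom τ σ) (b b' : Hom σ ρ), comp a (b + b') = comp a b + comp a b'
  smul_comp : ∀ {τ σ ρ} (z : ℂ) (a : Hom τ σ) (b : Hom σ ρ), comp (z • a) b = z • comp a b
  comp_smul : ∀ {τ σ ρ} (z : ℂ) (a : Hom τ σ) (b : Hom σ ρ), comp a (z • b) = z • comp a b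
  norm_comp_le : ∀ {τ σ ρ} (a : Hom τ σ) (b : Hom σ ρ), ‖comp a b‖ ≤ ‖a‖ * ‖b‖
  adj_add : ∀ {σ ρ} (a b : Hom σ ρ), adj (a + b) = adj a + adj b
  adj_smul : ∀ {σ ρ} (z : ℂ) (a : Hom σ ρ), adj (z • a) = star z • adj a
  adj_adj : ∀ {σ ρ} (a : Hom σ ρ), adj (adj a) = a
  adj_comp : ∀ {τ σ ρ} (a : Hom τ σ) (b : Hom σ ρ), adj (comp a b) = comp (adj b) (adj a)
  norm_adj_comp_self : ∀ {σ ρ} (a : Hom σ ρ), ‖comp (adj a) a‖ = ‖a‖ ^ 2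
  exists_adj_comp_self : ∀ {σ ρ} (a : Hom σ ρ), ∃ b : Hom ρ ρ, comp (adj a) a = comp (adj b) b

attribute [instance] CStarPrecategory.normedAddCommGroup CStarPrecategory.normedSpace
  CStarPrecategory.completeSpace

namespace CStarPrecategory

variable {Ob : Type u} (L : CStarPrecategory.{u, v} Ob)

/-- Composition as a bilinear map. -/
def compₗ (τ σ ρ : Ob) : L.Hom τ σ →ₗ[ℂ] L.Hom σ ρ →ₗ[ℂ] L.Hom τ ρ :=
  LinearMap.mk₂ ℂ L.comp L.add_comp L.smul_comp L.comp_add L.comp_smul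

variable {L}

@[simp] theorem zero_comp {τ σ ρ : Ob} (b : L.Hom σ ρ) : L.comp (0 : L.Hom τ σ) b = 0 :=
  LinearMap.map_zero₂ (L.compₗ τ σ ρ) b

@[simp] theorem comp_zero {τ σ ρ : Ob} (a : L.Hom τ σ) : L.comp a (0 : L.Hom σ ρ) = 0 :=
  (L.compₗ τ σ ρ a).map_zero

theorem sub_comp {τ σ ρ : Ob} (a a' : L.Hom τ σ) (b : L.Hom σ ρ) :
    L.comp (a - a') b = L.comp a b - L.comp a' b :=
  LinearMap.map_sub₂ (L.compₗ τ σ ρ) a a' b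

theorem comp_sub {τ σ ρ : Ob} (a : L.Hom τ σ) (b b' : L.Hom σ ρ) :
    L.comp a (b - b') = L.comp a b - L.comp a b' :=
  (L.compₗ τ σ ρ a).map_sub b b'

/-- The involution as a conjugate linear map. -/
def adjₗ (σ ρ : Ob) : L.Hom σ ρ →ₗ⋆[ℂ] L.Hom ρ σ where
  toFun := L.adj
  map_add' := L.adj_add
  map_smul' := L.adj_smul

theorem adj_sub {σ ρ : Ob} (a b : L.Hom σ ρ) : L.adj (a - b) = L.adj a - L.adj b :=
  (adjₗ σ ρ).map_sub a b

theorem norm_le_norm_adj {σ ρ : Ob} (a : L.Hom σ ρ) : ‖a‖ ≤ ‖L.adj a‖ := by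
  by_contra! h
  have h1 := L.norm_comp_le (L.adj a) a
  rw [L.norm_adj_comp_self] at h1
  nlinarith [norm_nonneg (L.adj a)]

theorem norm_adj {σ ρ : Ob} (a : L.Hom σ ρ) : ‖L.adj a‖ = ‖a‖ :=
  le_antisymm (by simpa [L.adj_adj] using norm_le_norm_adj (L.adj a)) (norm_le_norm_adj a)

theorem norm_comp_adj_self {σ ρ : Ob} (a : L.Hom σ ρ) : ‖L.comp a (L.adj a)‖ = ‖a‖ ^ 2 := by
  have := L.norm_adj_comp_self (L.adj a)
  rwa [L.adj_adj, norm_adj] at this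

theorem continuous_adj {σ ρ : Ob} : Continuous (L.adj : L.Hom σ ρ → L.Hom ρ σ) := by
  refine (AddMonoidHomClass.isometry_of_norm (adjₗ σ ρ : L.Hom σ ρ →ₗ⋆[ℂ] L.Hom ρ σ) ?_).continuous
  exact norm_adj

theorem continuous_comp {τ σ ρ : Ob} :
    Continuous fun x : L.Hom τ σ × L.Hom σ ρ => L.comp x.1 x.2 := by
  have h := ((L.compₗ τ σ ρ).mkContinuous₂ 1 fun a b => by
    rw [one_mul]; exact L.norm_comp_le a b).continuous₂
  exact h

/-- The endomorphisms of an object form a `C*`-algebra. -/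
instance instNonUnitalCStarAlgebra (ρ : Ob) : NonUnitalCStarAlgebra (L.Hom ρ ρ) where
  __ := L.normedAddCommGroup ρ ρ
  __ := L.normedSpace ρ ρ
  __ := L.completeSpace ρ ρ
  mul := L.comp
  left_distrib := L.comp_add
  right_distrib := L.add_comp
  zero_mul := zero_comp
  mul_zero := comp_zero
  mul_assoc := L.comp_assoc
  norm_mul_le := L.norm_comp_le
  star := L.adj
  star_involutive := L.adj_adj
  star_mul := L.adj_comp
  star_add := L.adj_add
  norm_mul_self_le a := by
    have := L.norm_adj_comp_self a
    rw [pow_two] at this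
    exact this.ge
  smul_assoc z a b := L.smul_comp z a b
  smul_comm z a b := (L.comp_smul z a b).symm
  star_smul := L.adj_smul

theorem mul_def {ρ : Ob} (a b : L.Hom ρ ρ) : a * b = L.comp a b := rfl

theorem star_def {ρ : Ob} (a : L.Hom ρ ρ) : star a = L.adj a := rfl

/-- Approximate left units: `e a` approximates `a` for suitable `e` in the `C*`-algebra generated
by `a a*`. -/
theorem exists_approx {σ ρ : Ob} (a : L.Hom σ ρ) (ε : ℝ) (hε : 0 < ε) :
    ∃ e ∈ NonUnitalStarAlgebra.elemental ℂ (L.comp a (L.adj a)), ‖a - L.comp e a‖ < ε := by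
  set h : L.Hom σ σ := L.comp a (L.adj a) with hh
  let S := NonUnitalStarAlgebra.elemental ℂ h
  let _ := CStarAlgebra.spectralOrder S
  have := CStarAlgebra.spectralOrderedRing S
  have hU := CStarAlgebra.increasingApproximateUnit S
  have := hU.neBot
  let h' : S := ⟨h, NonUnitalStarAlgebra.elemental.self_mem ℂ h⟩
  have h1 := hU.tendsto_mul_right h'
  have h2 := Metric.tendsto_nhds.1 h1 (ε ^ 2 / 2) (by positivity)
  obtain ⟨e, he, he1⟩ := (h2.and hU.eventually_norm).exists
  refine ⟨e.1, e.2, ?_⟩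
  have h3 : ‖h - e.1 * h‖ < ε ^ 2 / 2 := by
    rw [dist_comm, dist_eq_norm] at he
    exact he
  have h4 : L.comp (a - L.comp e.1 a) (L.adj (a - L.comp e.1 a)) =
      (h - e.1 * h) - (h - e.1 * h) * star e.1 := by
    simp only [mul_def, star_def, adj_sub, sub_comp, comp_sub, L.adj_comp, hh, L.comp_assoc]
  have h5 : ‖a - L.comp e.1 a‖ ^ 2 < ε ^ 2 := by
    rw [← norm_comp_adj_self, h4]
    have h6 : ‖(h - e.1 * h) * star e.1‖ ≤ ‖h - e.1 * h‖ := by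
      refine (norm_mul_le _ _).trans ?_
      rw [norm_star]
      exact mul_le_of_le_one_right (norm_nonneg _) he1
    calc _ ≤ _ := norm_sub_le _ _
      _ < _ := by linarith
  exact lt_of_pow_lt_pow_left₀ 2 hε.le h5

variable (L)

/-- An ideal in a `C*`-precategory. -/
structure Ideal where
  carrier : ∀ σ ρ, Submodule ℂ (L.Hom σ ρ)
  isClosed : ∀ σ ρ, IsClosed (carrier σ ρ : Set (L.Hom σ ρ))
  comp_mem_left : ∀ {τ σ ρ} (a : L.Hom τ σ) {b : L.Hom σ ρ},
    b ∈ carrier σ ρ → L.comp a b ∈ carrier τ ρ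
  comp_mem_right : ∀ {τ σ ρ} {a : L.Hom τ σ} (b : L.Hom σ ρ),
    a ∈ carrier τ σ → L.comp a b ∈ carrier τ ρ

namespace Ideal

variable {L} (K : L.Ideal)

theorem elemental_subset {ρ : Ob} {h : L.Hom ρ ρ} (hs : L.adj h = h) (hK : h ∈ K.carrier ρ ρ)
    {e : L.Hom ρ ρ} (he : e ∈ NonUnitalStarAlgebra.elemental ℂ h) : e ∈ K.carrier ρ ρ := by
  have h1 : ∀ x ∈ NonUnitalStarAlgebra.adjoin ℂ {h},
      x ∈ K.carrier ρ ρ ∧ star x ∈ K.carrier ρ ρ := by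
    intro x hx
    induction hx using NonUnitalStarAlgebra.adjoin_induction with
    | mem x hx =>
      rw [Set.mem_singleton_iff.1 hx]
      exact ⟨hK, by rw [star_def, hs]; exact hK⟩
    | add x y _ _ hx hy =>
      exact ⟨add_mem hx.1 hy.1, by rw [star_add]; exact add_mem hx.2 hy.2⟩
    | zero => exact ⟨zero_mem _, by rw [star_zero]; exact zero_mem _⟩
    | mul x y _ _ hx hy =>
      exact ⟨K.comp_mem_left x hy.1, by rw [star_mul]; exact K.comp_mem_left _ hx.2⟩
    | smul r x _ hx =>
      exact ⟨Submodule.smul_mem _ _ hx.1, by rw [star_smul]; exact Submodule.smul_mem _ _ hx.2⟩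
    | star x _ hx => exact ⟨hx.2, by rw [star_star]; exact hx.1⟩
  exact closure_minimal (fun x hx => (h1 x hx).1) (K.isClosed ρ ρ) he

/-- Elements `a` with `a a*` in the ideal are approximated by `e a` with `e` in the ideal. -/
theorem exists_approx {σ ρ : Ob} {a : L.Hom σ ρ} (ha : L.comp a (L.adj a) ∈ K.carrier σ σ)
    (ε : ℝ) (hε : 0 < ε) : ∃ e ∈ K.carrier σ σ, ‖a - L.comp e a‖ < ε := by
  obtain ⟨e, he, h⟩ := CStarPrecategory.exists_approx a ε hε
  exact ⟨e, K.elemental_subset (by rw [L.adj_comp, L.adj_adj]) ha he, h⟩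

/-- An ideal is automatically self-adjoint. -/
theorem adj_mem {σ ρ : Ob} {a : L.Hom σ ρ} (ha : a ∈ K.carrier σ ρ) :
    L.adj a ∈ K.carrier ρ σ := by
  rw [← SetLike.mem_coe, ← (K.isClosed ρ σ).closure_eq, Metric.mem_closure_iff]
  intro ε hε
  have h : L.comp (L.adj a) (L.adj (L.adj a)) ∈ K.carrier ρ ρ := by
    rw [L.adj_adj]
    exact K.comp_mem_left _ ha
  obtain ⟨e, he, h1⟩ := K.exists_approx h ε hε
  exact ⟨L.comp e (L.adj a), K.comp_mem_right _ he, by rwa [dist_eq_norm]⟩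

/-- The diagonal `C*`-algebra `K(ρ, ρ)`. -/
def diag (ρ : Ob) : NonUnitalStarSubalgebra ℂ (L.Hom ρ ρ) where
  carrier := K.carrier ρ ρ
  add_mem' := add_mem
  zero_mem' := zero_mem _
  mul_mem' {a _} _ hb := K.comp_mem_left a hb
  smul_mem' z _ ha := Submodule.smul_mem _ z ha
  star_mem' ha := K.adj_mem ha

instance (ρ : Ob) : IsClosed (K.diag ρ : Set (L.Hom ρ ρ)) := K.isClosed ρ ρ

theorem exists_sqrt {σ ρ : Ob} (x : L.Hom σ ρ) (hx : x ∈ K.carrier σ ρ) :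
    ∃ b ∈ K.carrier ρ ρ, L.comp (L.adj x) x = L.comp b (L.adj b) := by
  let _ := CStarAlgebra.spectralOrder (L.Hom ρ ρ)
  have := CStarAlgebra.spectralOrderedRing (L.Hom ρ ρ)
  have h0 : 0 ≤ L.comp (L.adj x) x := by
    obtain ⟨b, hb⟩ := L.exists_adj_comp_self x
    rw [hb]
    exact star_mul_self_nonneg (b : L.Hom ρ ρ)
  refine ⟨CFC.sqrt (L.comp (L.adj x) x), ?_, ?_⟩
  · have : CFC.sqrt (L.comp (L.adj x) x) ∈ K.diag ρ := by
      rw [CFC.sqrt, cfcₙ_nnreal_eq_real _ _ h0]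
      exact cfcₙ_mem (𝕜 := ℝ) (𝕜' := ℂ) _ (K.comp_mem_left _ hx)
    exact this
  · have h1 : IsSelfAdjoint (CFC.sqrt (L.comp (L.adj x) x)) :=
      IsSelfAdjoint.of_nonneg (CFC.sqrt_nonneg _)
    have h2 := h1.star_eq
    rw [star_def] at h2
    rw [h2]
    exact (CFC.sqrt_mul_sqrt_self _ h0).symm

open scoped Classical in
/-- The `C*`-algebraic direct sum `⨁ K(t, t)`, as the `C*`-subalgebra of the product `∏ 𝓛(t, t)`
generated by the summands. -/
def directSum : NonUnitalStarSubalgebra ℂ (lp (fun t => L.Hom t t) ∞) :=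
  (NonUnitalStarAlgebra.adjoin ℂ
    {f | ∃ t, ∃ a ∈ K.carrier t t, f = lp.single (E := fun t => L.Hom t t) ∞ t a}).topologicalClosure

instance : IsClosed (K.directSum : Set (lp (fun t => L.Hom t t) ∞)) :=
  NonUnitalStarSubalgebra.isClosed_topologicalClosure _

/-- The coefficient algebra of the Fock module. Mathlib's Hilbert modules carry a left action, so a
right Hilbert module over `⨁ K(t, t)` is a Hilbert module over its opposite algebra. -/
def Coeff : Type max u v := (↥K.directSum)ᵐᵒᵖ

instance : NonUnitalCStarAlgebra K.Coeff :=
  inferInstanceAs (NonUnitalCStarAlgebra (↥K.directSum)ᵐᵒᵖ)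

instance : PartialOrder K.Coeff := CStarAlgebra.spectralOrder _

instance : StarOrderedRing K.Coeff := CStarAlgebra.spectralOrderedRing _

open scoped Classical in
/-- The embedding of the summand `K(t, t)`. -/
def coeff {t : Ob} (a : K.carrier t t) : K.Coeff :=
  MulOpposite.op ⟨lp.single (E := fun t => L.Hom t t) ∞ t a.1, NonUnitalStarSubalgebra.le_topologicalClosure _
    (NonUnitalStarAlgebra.subset_adjoin _ _ ⟨t, a.1, a.2, rfl⟩)⟩

theorem coeff_ext {x y : K.Coeff}
    (h : ∀ t, (MulOpposite.unop x).1.1 t = (MulOpposite.unop y).1.1 t) : x = y :=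
  MulOpposite.unop_injective (Subtype.ext (lp.ext (funext h)))

theorem norm_coeff {t : Ob} (a : K.carrier t t) : ‖K.coeff a‖ = ‖a‖ := by
  classical
  change ‖lp.single (E := fun t => L.Hom t t) ∞ t a.1‖ = ‖a.1‖
  convert lp.norm_single (E := fun t => L.Hom t t) (p := ∞) (by simp) t a.1

open scoped Classical in
theorem coeff_val {t : Ob} (a : K.carrier t t) :
    (MulOpposite.unop (K.coeff a)).1 = lp.single (E := fun t => L.Hom t t) ∞ t a.1 := rfl

theorem coeff_add {t : Ob} (a b : K.carrier t t) : K.coeff (a + b) = K.coeff a + K.coeff b := by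
  classical
  exact MulOpposite.unop_injective (Subtype.ext (lp.single_add (E := fun t => L.Hom t t) ∞ t a.1 b.1))

theorem coeff_smul {t : Ob} (z : ℂ) (a : K.carrier t t) : K.coeff (z • a) = z • K.coeff a := by
  classical
  exact MulOpposite.unop_injective
    (Subtype.ext (lp.single_smul (E := fun t => L.Hom t t) ∞ t z a.1))

theorem coeff_star {t : Ob} (a : K.carrier t t) :
    star (K.coeff a) = K.coeff ⟨L.adj a.1, K.adj_mem a.2⟩ := by
  classical
  refine MulOpposite.unop_injective (Subtype.ext (lp.ext (funext fun s => ?_)))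
  change star (Pi.single (M := fun t => L.Hom t t) t a.1 s) =
    Pi.single (M := fun t => L.Hom t t) t (star a.1) s
  by_cases h : s = t
  · subst h
    rw [Pi.single_eq_same, Pi.single_eq_same]
  · rw [Pi.single_eq_of_ne h, Pi.single_eq_of_ne h, star_zero]

theorem mul_coeff {t : Ob} (x : K.Coeff) (a : K.carrier t t) :
    x * K.coeff a =
      K.coeff ⟨L.comp a.1 ((MulOpposite.unop x).1.1 t), K.comp_mem_right _ a.2⟩ := by
  classical
  refine MulOpposite.unop_injective (Subtype.ext (lp.ext (funext fun s => ?_)))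
  change Pi.single (M := fun t => L.Hom t t) t a.1 s * (MulOpposite.unop x).1.1 s =
    Pi.single (M := fun t => L.Hom t t) t (a.1 * (MulOpposite.unop x).1.1 t) s
  by_cases h : s = t
  · subst h
    rw [Pi.single_eq_same, Pi.single_eq_same]
  · rw [Pi.single_eq_of_ne h, Pi.single_eq_of_ne h, zero_mul]

theorem coeff_nonneg {σ t : Ob} (x : K.carrier σ t) :
    0 ≤ K.coeff ⟨L.comp (L.adj x.1) x.1, K.comp_mem_left _ x.2⟩ := by
  classical
  obtain ⟨b, hb, h⟩ := K.exists_sqrt x.1 x.2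
  have : K.coeff ⟨L.comp (L.adj x.1) x.1, K.comp_mem_left _ x.2⟩ =
      star (K.coeff ⟨b, hb⟩) * K.coeff ⟨b, hb⟩ := by
    rw [mul_coeff, coeff_star]
    congr 1
    refine Subtype.ext (h.trans ?_)
    change _ = L.comp b (Pi.single (M := fun t => L.Hom t t) t (L.adj b) t)
    rw [Pi.single_eq_same]
  rw [this]
  exact star_mul_self_nonneg _

instance {s t : Ob} : SMul K.Coeff (K.carrier s t) where
  smul a x := ⟨L.comp x.1 ((MulOpposite.unop a).1.1 t), K.comp_mem_right _ x.2⟩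

/-- The Hilbert module `X_{s,t} = K(s, t)` with `⟪x, y⟫ = x* y`. -/
instance {s t : Ob} : CStarModule K.Coeff (K.carrier s t) where
  inner x y := K.coeff ⟨L.comp (L.adj x.1) y.1, K.comp_mem_left _ y.2⟩
  inner_add_right {x y z} := by
    rw [← coeff_add]
    exact congrArg K.coeff (Subtype.ext (L.comp_add _ _ _))
  inner_self_nonneg {x} := K.coeff_nonneg x
  inner_self {x} := by
    rw [← norm_eq_zero, norm_coeff]
    change ‖L.comp (L.adj x.1) x.1‖ = 0 ↔ _
    rw [L.norm_adj_comp_self, sq_eq_zero_iff, norm_eq_zero]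
    exact ⟨fun h => Subtype.ext h, fun h => congrArg Subtype.val h⟩
  inner_op_smul_right {a x y} := by
    rw [mul_coeff]
    exact congrArg K.coeff (Subtype.ext (L.comp_assoc _ _ _).symm)
  inner_smul_right_complex {z x y} := by
    rw [← coeff_smul]
    exact congrArg K.coeff (Subtype.ext (L.comp_smul _ _ _))
  star_inner x y := by
    rw [coeff_star]
    exact congrArg K.coeff (Subtype.ext (by simp only [L.adj_comp, L.adj_adj]))
  norm_eq_sqrt_norm_inner_self x := by
    rw [norm_coeff]
    change ‖x.1‖ = √‖L.comp (L.adj x.1) x.1‖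
    rw [L.norm_adj_comp_self, Real.sqrt_sq (norm_nonneg _)]

theorem inner_eq {s t : Ob} (x y : K.carrier s t) :
    inner K.Coeff x y = K.coeff ⟨L.comp (L.adj x.1) y.1, K.comp_mem_left _ y.2⟩ := rfl

instance {s t : Ob} : CompleteSpace (K.carrier s t) := (K.isClosed s t).completeSpace_coe

/-- Left composition with a morphism `b ∈ 𝓛(r, s)`. -/
def lmul {r s t : Ob} (b : L.Hom r s) (x : K.carrier s t) : K.carrier r t :=
  ⟨L.comp b x.1, K.comp_mem_left _ x.2⟩

theorem inner_lmul_left {r s t : Ob} (b : L.Hom r s) (x : K.carrier s t) (y : K.carrier r t) :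
    inner K.Coeff (K.lmul b x) y = inner K.Coeff x (K.lmul (L.adj b) y) :=
  congrArg K.coeff (Subtype.ext (by simp only [lmul, L.adj_comp, L.comp_assoc]))

theorem inner_lmul_self_le {r s t : Ob} (b : L.Hom r s) (x : K.carrier s t) :
    inner K.Coeff (K.lmul b x) (K.lmul b x) ≤ ‖b‖ ^ 2 • inner K.Coeff x x := by
  let c : L.Hom s s := L.comp (L.adj b) b
  have hc : L.adj c = c := by simp only [c, L.adj_comp, L.adj_adj]
  let C : Adjointable K.Coeff (K.carrier s t) := Adjointable.ofPair (K.lmul c) (K.lmul c)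
    fun x y => by rw [inner_lmul_left, hc]
  have hC : IsSelfAdjoint C := Adjointable.star_ofPair _ _ _ _
  have hn : ‖C‖ ≤ ‖b‖ ^ 2 := by
    refine ContinuousLinearMap.opNorm_le_bound _ (by positivity) fun y => ?_
    rw [← L.norm_adj_comp_self]
    exact L.norm_comp_le c y.1
  have h1 := Adjointable.inner_le_of_isSelfAdjoint C hC x
  have h2 : inner K.Coeff (K.lmul b x) (K.lmul b x) = inner K.Coeff x (C.1 x) := by
    rw [inner_lmul_left]
    exact congrArg (inner K.Coeff x) (Subtype.ext (L.comp_assoc _ _ _).symm)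
  rw [h2]
  refine h1.trans ?_
  have := CStarModule.inner_self_nonneg (A := K.Coeff) (x := x)
  gcongr

/-- The Fock module `⨁_{s,t} X_{s,t}`. -/
abbrev Fock : Type max u v := HilbertSum K.Coeff fun i : Ob × Ob => K.carrier i.1 i.2

end Ideal

end CStarPrecategory

/-- The principal right ideal `pP`. -/
def rightIdeal {P : Type u} [Monoid P] (p : P) : Set P := Set.range fun x => p * x

/-- Right LCM semigroups (with identity): left cancellative, and the intersection of two principal
right ideals is empty or a principal right ideal. -/
class IsRightLCM (P : Type u) [Monoid P] : Prop extends IsLeftCancelMul P where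
  inter : ∀ p q : P, rightIdeal p ∩ rightIdeal q = ∅ ∨
    ∃ r : P, rightIdeal p ∩ rightIdeal q = rightIdeal r

/-- A right-tensor `C*`-precategory over `P`. The morphism `a ⊗ 1_r ∈ 𝓛(pr, qr)` of `a ∈ 𝓛(p, q)` is
written `tensor r hp hq a` where `hp : p * r = p'` and `hq : q * r = q'` allow `pr` and `qr` to be
presented by other names. -/
structure RightTensorCStarPrecategory (P : Type u) [Monoid P] extends
    CStarPrecategory.{u, v} P where
  tensor : ∀ (r : P) {p q p' q' : P}, p * r = p' → q * r = q' → Hom p q → Hom p' q'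
  tensor_add : ∀ (r : P) {p q p' q' : P} (hp : p * r = p') (hq : q * r = q') (a b : Hom p q),
    tensor r hp hq (a + b) = tensor r hp hq a + tensor r hp hq b
  tensor_smul : ∀ (r : P) {p q p' q' : P} (hp : p * r = p') (hq : q * r = q') (z : ℂ)
    (a : Hom p q), tensor r hp hq (z • a) = z • tensor r hp hq a
  tensor_comp : ∀ (r : P) {p q s p' q' s' : P} (hp : p * r = p') (hq : q * r = q')
    (hs : s * r = s') (a : Hom p q) (b : Hom q s),
    tensor r hp hs (comp a b) = comp (tensor r hp hq a) (tensor r hq hs b)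
  tensor_adj : ∀ (r : P) {p q p' q' : P} (hp : p * r = p') (hq : q * r = q') (a : Hom p q),
    tensor r hq hp (adj a) = adj (tensor r hp hq a)
  tensor_one : ∀ {p q : P} (a : Hom p q), tensor 1 (mul_one p) (mul_one q) a = a
  tensor_tensor : ∀ (r s : P) {p q p' q' p'' q'' : P} (hp : p * r = p') (hq : q * r = q')
    (hp' : p' * s = p'') (hq' : q' * s = q'') (a : Hom p q),
    tensor s hp' hq' (tensor r hp hq a) =
      tensor (r * s) (by rw [← mul_assoc, hp, hp']) (by rw [← mul_assoc, hq, hq']) a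

theorem summable_of_nonneg_of_le {A : Type*} [NonUnitalCStarAlgebra A] [PartialOrder A]
    [StarOrderedRing A] {ι : Type*} {f g : ι → A} (h0 : ∀ i, 0 ≤ f i) (h : ∀ i, f i ≤ g i)
    (hg : Summable g) : Summable f := by
  rw [summable_iff_vanishing_norm] at *
  intro ε hε
  obtain ⟨s, hs⟩ := hg ε hε
  exact ⟨s, fun t ht => (CStarAlgebra.norm_le_norm_of_nonneg_of_le
    (Finset.sum_nonneg fun i _ => h0 i) (Finset.sum_le_sum fun i _ => h i)).trans_lt (hs t ht)⟩

namespace RightTensorCStarPrecategory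

variable {P : Type u} [Monoid P] (L : RightTensorCStarPrecategory.{u, v} P)

variable {L} in
theorem norm_tensor_le (r : P) {p q p' q' : P} (hp : p * r = p') (hq : q * r = q')
    (a : L.Hom p q) : ‖L.tensor r hp hq a‖ ≤ ‖a‖ := by
  let φ : L.Hom q q →⋆ₙₐ[ℂ] L.Hom q' q' :=
    { toFun := L.tensor r hq hq
      map_smul' := L.tensor_smul r hq hq
      map_zero' := by
        have := L.tensor_smul r hq hq 0 0
        rwa [zero_smul, zero_smul] at this
      map_add' := L.tensor_add r hq hq
      map_mul' := L.tensor_comp r hq hq hq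
      map_star' := L.tensor_adj r hq hq }
  have h := NonUnitalStarAlgHom.norm_apply_le φ (L.comp (L.adj a) a)
  have h2 : φ (L.comp (L.adj a) a) =
      L.comp (L.adj (L.tensor r hp hq a)) (L.tensor r hp hq a) := by
    rw [← L.tensor_adj]
    exact L.tensor_comp r hq hp hq (L.adj a) a
  rw [h2, L.norm_adj_comp_self, L.norm_adj_comp_self] at h
  exact (sq_le_sq₀ (norm_nonneg _) (norm_nonneg _)).1 h

variable (K : L.toCStarPrecategory.Ideal)

/-- Well-aligned ideals: `(a ⊗ 1_{p⁻¹r}) (b ⊗ 1_{q⁻¹r}) ∈ K(r, r)` for `a ∈ K(p, p)`,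
`b ∈ K(q, q)` whenever `pP ∩ qP = rP`; here `u = p⁻¹r` and `v = q⁻¹r`. -/
def WellAligned : Prop :=
  ∀ (p q r u v : P) (hu : p * u = r) (hv : q * v = r),
    rightIdeal p ∩ rightIdeal q = rightIdeal r →
    ∀ a ∈ K.carrier p p, ∀ b ∈ K.carrier q q,
      L.comp (L.tensor u hu hu a) (L.tensor v hv hv b) ∈ K.carrier r r

variable {L K} in
/-- For a well-aligned ideal the alignment relation also holds off the diagonal. -/
theorem WellAligned.comp_mem (hK : L.WellAligned K) {p q s t r u v : P} (hu : q * u = r)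
    (hv : s * v = r) (hr : rightIdeal q ∩ rightIdeal s = rightIdeal r) {a : L.Hom p q}
    (ha : a ∈ K.carrier p q) {b : L.Hom s t} (hb : b ∈ K.carrier s t) :
    L.comp (L.tensor u rfl hu a) (L.tensor v hv rfl b) ∈ K.carrier (p * u) (t * v) := by
  have hsub : ∀ {x y : P} (w : P) {x' y' : P} (hx : x * w = x') (hy : y * w = y')
      (c d : L.Hom x y), L.tensor w hx hy (c - d) = L.tensor w hx hy c - L.tensor w hx hy d := by
    intro x y w x' y' hx hy c d
    rw [sub_eq_add_neg, L.tensor_add, ← neg_one_smul ℂ, L.tensor_smul, neg_one_smul,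
      ← sub_eq_add_neg]
  -- approximate `b` by `f b` with `f` in the ideal
  have step : ∀ a' ∈ K.carrier q q,
      L.comp (L.tensor u hu hu a') (L.tensor v hv rfl b) ∈ K.carrier r (t * v) := by
    intro a' ha'
    rw [← SetLike.mem_coe, ← (K.isClosed _ _).closure_eq, Metric.mem_closure_iff]
    intro ε hε
    obtain ⟨f, hf, h⟩ := K.exists_approx (a := b) (K.comp_mem_right _ hb) (ε / (‖a'‖ + 1))
      (by positivity)
    refine ⟨L.comp (L.tensor u hu hu a') (L.tensor v hv rfl (L.comp f b)), ?_, ?_⟩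
    · rw [SetLike.mem_coe, L.tensor_comp v hv hv rfl, ← L.comp_assoc]
      exact K.comp_mem_right _ (hK q s r u v hu hv hr a' ha' f hf)
    · rw [dist_eq_norm, ← CStarPrecategory.comp_sub, ← hsub]
      refine (L.norm_comp_le _ _).trans_lt ?_
      have h1 := norm_tensor_le u hu hu a'
      have h2 := norm_tensor_le v hv rfl (b - L.comp f b)
      rw [lt_div_iff₀ (by positivity)] at h
      calc _ ≤ ‖a'‖ * ‖b - L.comp f b‖ := by gcongr
        _ ≤ ‖b - L.comp f b‖ * (‖a'‖ + 1) := by nlinarith [norm_nonneg (b - L.comp f b)]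
        _ < ε := h
  rw [← SetLike.mem_coe, ← (K.isClosed _ _).closure_eq, Metric.mem_closure_iff]
  intro ε hε
  obtain ⟨e, he, h⟩ := K.exists_approx (a := L.adj a)
    (by rw [L.adj_adj]; exact K.comp_mem_left _ ha) (ε / (‖b‖ + 1)) (by positivity)
  have h' : ‖a - L.comp a (L.adj e)‖ < ε / (‖b‖ + 1) := by
    rw [← CStarPrecategory.norm_adj, CStarPrecategory.adj_sub, L.adj_comp, L.adj_adj]
    exact h
  refine ⟨L.comp (L.tensor u rfl hu (L.comp a (L.adj e))) (L.tensor v hv rfl b), ?_, ?_⟩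
  · rw [SetLike.mem_coe, L.tensor_comp u rfl hu hu, L.comp_assoc]
    exact K.comp_mem_left _ (step _ (K.adj_mem he))
  · rw [dist_eq_norm, ← CStarPrecategory.sub_comp, ← hsub]
    refine (L.norm_comp_le _ _).trans_lt ?_
    have h1 := norm_tensor_le u rfl hu (a - L.comp a (L.adj e))
    have h2 := norm_tensor_le v hv rfl b
    rw [lt_div_iff₀ (by positivity)] at h'
    calc _ ≤ ‖a - L.comp a (L.adj e)‖ * ‖b‖ := by gcongr
      _ ≤ ‖a - L.comp a (L.adj e)‖ * (‖b‖ + 1) := by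
        nlinarith [norm_nonneg (a - L.comp a (L.adj e))]
      _ < ε := h'

end RightTensorCStarPrecategory

/-- A representation of (the `C*`-precategory) `K` in a `C*`-algebra `B`. -/
structure CStarPrecategory.Ideal.Representation {Ob : Type u} {L : CStarPrecategory.{u, v} Ob}
    (K : L.Ideal) (B : Type*) [NonUnitalCStarAlgebra B] where
  map : ∀ {p q : Ob}, K.carrier p q →ₗ[ℂ] B
  map_adj : ∀ {p q : Ob} (a : K.carrier p q),
    map ⟨L.adj a.1, K.adj_mem a.2⟩ = star (map a)
  map_comp : ∀ {p q r : Ob} (a : K.carrier p q) (b : K.carrier q r),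
    map ⟨L.comp a.1 b.1, K.comp_mem_left _ b.2⟩ = map a * map b

namespace CStarPrecategory.Ideal.Representation

variable {Ob : Type u} {L : CStarPrecategory.{u, v} Ob} {K : L.Ideal} {B : Type*}
  [NonUnitalCStarAlgebra B] (Φ : K.Representation B)

theorem norm_map_le {p q : Ob} (a : K.carrier p q) : ‖Φ.map a‖ ≤ ‖a‖ := by
  let φ : K.diag q →⋆ₙₐ[ℂ] B :=
    { toFun := fun x => Φ.map ⟨x.1, x.2⟩
      map_smul' := fun z x => Φ.map.map_smul z ⟨x.1, x.2⟩
      map_zero' := Φ.map.map_zero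
      map_add' := fun x y => Φ.map.map_add ⟨x.1, x.2⟩ ⟨y.1, y.2⟩
      map_mul' := fun x y => Φ.map_comp ⟨x.1, x.2⟩ ⟨y.1, y.2⟩
      map_star' := fun x => Φ.map_adj ⟨x.1, x.2⟩ }
  have h : ‖φ ⟨L.comp (L.adj a.1) a.1, K.comp_mem_left _ a.2⟩‖ ≤ ‖L.comp (L.adj a.1) a.1‖ :=
    NonUnitalStarAlgHom.norm_apply_le φ _
  have h2 : φ ⟨L.comp (L.adj a.1) a.1, K.comp_mem_left _ a.2⟩ = star (Φ.map a) * Φ.map a := by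
    rw [← Φ.map_adj]
    exact Φ.map_comp ⟨L.adj a.1, K.adj_mem a.2⟩ a
  rw [h2, L.norm_adj_comp_self, CStarRing.norm_star_mul_self, ← pow_two] at h
  exact (sq_le_sq₀ (norm_nonneg _) (norm_nonneg _)).1 h

/-- `C*(Φ(K))`, the `C*`-subalgebra of `B` generated by the spaces `Φ(K(p, q))`. -/
def algebra : NonUnitalStarSubalgebra ℂ B :=
  (NonUnitalStarAlgebra.adjoin ℂ {b | ∃ p q, ∃ a : K.carrier p q, b = Φ.map a}).topologicalClosure

instance : IsClosed (Φ.algebra : Set B) :=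
  NonUnitalStarSubalgebra.isClosed_topologicalClosure _

/-- `Φ(a)` as an element of `C*(Φ(K))`. -/
def toAlgebra {p q : Ob} (a : K.carrier p q) : Φ.algebra :=
  ⟨Φ.map a, NonUnitalStarSubalgebra.le_topologicalClosure _
    (NonUnitalStarAlgebra.subset_adjoin _ _ ⟨p, q, a, rfl⟩)⟩

end CStarPrecategory.Ideal.Representation

namespace RightTensorCStarPrecategory

variable {P : Type u} [Monoid P] {L : RightTensorCStarPrecategory.{u, v} P}
  {K : L.toCStarPrecategory.Ideal}

/-- Nica covariance of a representation of `K`, where `u = q⁻¹r` and `v = s⁻¹r`. For a well-aligned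
ideal the membership `hc` is automatic. -/
def NicaCovariant {B : Type*} [NonUnitalCStarAlgebra B] (Φ : K.Representation B) : Prop :=
  ∀ (p q s t : P) (a : K.carrier p q) (b : K.carrier s t),
    (∀ (r u v : P) (hu : q * u = r) (hv : s * v = r),
      rightIdeal q ∩ rightIdeal s = rightIdeal r →
      ∀ hc : L.comp (L.tensor u rfl hu a.1) (L.tensor v hv rfl b.1) ∈ K.carrier (p * u) (t * v),
        Φ.map a * Φ.map b = Φ.map ⟨_, hc⟩) ∧
    ((¬ ∃ r, rightIdeal q ∩ rightIdeal s = rightIdeal r) → Φ.map a * Φ.map b = 0)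

section Fock

variable (K)

open scoped Classical in
/-- The family of blocks `T_{p,q}^{s,t}(a) : X_{s,t} → X_{pq⁻¹s,t}`, `x ↦ (a ⊗ 1_u) x`, over all
`s = qu` with `u ∈ C`, assembled to a map on families. -/
def blockFun (C : Set P) {p q : P} (a : L.Hom p q) (x : ∀ i : P × P, K.carrier i.1 i.2)
    (i : P × P) : K.carrier i.1 i.2 :=
  if h : ∃ u, u ∈ C ∧ p * u = i.1 then
    K.lmul (L.tensor h.choose h.choose_spec.2 rfl a) (x (q * h.choose, i.2)) else 0

variable [IsLeftCancelMul P]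

theorem blockFun_of_mem {C : Set P} {p q : P} (a : L.Hom p q) (x : ∀ i : P × P, K.carrier i.1 i.2)
    {u i k t : P} (hu : u ∈ C) (hi : p * u = i) (hk : q * u = k) :
    blockFun K C a x (i, t) = K.lmul (L.tensor u hi hk a) (x (k, t)) := by
  have h : ∃ u, u ∈ C ∧ p * u = (i, t).1 := ⟨u, hu, hi⟩
  have key : ∀ w (hw : p * w = i) , K.lmul (L.tensor w hw rfl a) (x (q * w, t)) =
      K.lmul (L.tensor u hi hk a) (x (k, t)) := by
    intro w hw
    obtain rfl : w = u := mul_left_cancel (hw.trans hi.symm)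
    subst hk
    rfl
  rw [blockFun, dif_pos h]
  exact key _ _

theorem blockFun_of_notMem {C : Set P} {p q : P} (a : L.Hom p q)
    (x : ∀ i : P × P, K.carrier i.1 i.2) {i : P × P} (h : ¬ ∃ u, u ∈ C ∧ p * u = i.1) :
    blockFun K C a x i = 0 := dif_neg h

/-- The injection `(u, t) ↦ (pu, t)`. -/
def shift (C : Set P) (p : P) (c : C × P) : P × P := (p * c.1.1, c.2)

theorem shift_injective (C : Set P) (p : P) : Function.Injective (shift C p) := by
  rintro ⟨⟨u, hu⟩, t⟩ ⟨⟨v, hv⟩, s⟩ h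
  simp only [shift, Prod.mk.injEq] at h
  obtain ⟨h1, rfl⟩ := h
  obtain rfl := mul_left_cancel h1
  rfl

theorem blockFun_of_notMem_range {C : Set P} {p q : P} (a : L.Hom p q)
    (x : ∀ i : P × P, K.carrier i.1 i.2) {i : P × P} (h : i ∉ Set.range (shift C p)) :
    blockFun K C a x i = 0 :=
  blockFun_of_notMem K a x fun ⟨u, hu, hi⟩ => h ⟨(⟨u, hu⟩, i.2), Prod.ext hi rfl⟩

theorem blockFun_shift {C : Set P} {p q : P} (a : L.Hom p q)
    (x : ∀ i : P × P, K.carrier i.1 i.2) (c : C × P) :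
    blockFun K C a x (shift C p c) = K.lmul (L.tensor c.1.1 rfl rfl a) (x (shift C q c)) :=
  blockFun_of_mem K a x c.1.2 rfl rfl

/-- The map on the Fock module given by a family of blocks. -/
def block (C : Set P) {p q : P} (a : L.Hom p q) (x : K.Fock) : K.Fock :=
  ⟨blockFun K C a x.1, by
    refine ((shift_injective C p).summable_iff fun i hi => ?_).1 ?_
    · rw [blockFun_of_notMem_range K a x.1 hi]
      exact CStarModule.inner_zero_right
    · have h := ((x.summable x).comp_injective (shift_injective C q)).const_smul (‖a‖ ^ 2)
      refine summable_of_nonneg_of_le (fun c => CStarModule.inner_self_nonneg) (fun c => ?_) h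
      simp only [Function.comp_apply]
      rw [blockFun_shift]
      refine (K.inner_lmul_self_le _ _).trans ?_
      have h1 := norm_tensor_le (L := L) c.1.1 rfl rfl a
      have h2 := CStarModule.inner_self_nonneg (A := K.Coeff) (x := x.1 (shift C q c))
      exact smul_le_smul_of_nonneg_right (pow_le_pow_left₀ (norm_nonneg _) h1 2) h2⟩

theorem inner_block_left (C : Set P) {p q : P} (a : L.Hom p q) (x y : K.Fock) :
    inner K.Coeff (block K C a x) y = inner K.Coeff x (block K C (L.adj a) y) := by
  change ∑' i, inner K.Coeff (blockFun K C a x.1 i) (y.1 i) =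
    ∑' i, inner K.Coeff (x.1 i) (blockFun K C (L.adj a) y.1 i)
  rw [← (shift_injective C p).tsum_eq, ← (shift_injective C q).tsum_eq]
  · refine tsum_congr fun c => ?_
    rw [blockFun_shift, blockFun_shift, L.tensor_adj]
    exact K.inner_lmul_left _ _ _
  · intro i hi
    by_contra h
    exact hi (by simp only [blockFun_of_notMem_range K _ _ h]; exact CStarModule.inner_zero_right)
  · intro i hi
    by_contra h
    exact hi (by simp only [blockFun_of_notMem_range K _ _ h]; exact CStarModule.inner_zero_left)

/-- The adjointable operator `⨁_{u ∈ C, t ∈ P} T_{p,q}^{qu,t}(a)` on the Fock module. -/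
def blockOp (C : Set P) {p q : P} (a : L.Hom p q) : Adjointable K.Coeff K.Fock :=
  Adjointable.ofPair (block K C a) (block K C (L.adj a)) (inner_block_left K C a)

/-- The Fock operator: `T(a) x = (a ⊗ 1_{q⁻¹s}) x` for `x ∈ X_{s,t}` with `s ∈ qP`, and `T(a) x = 0`
for `x ∈ X_{s,t}` with `s ∉ qP`, where `a ∈ 𝓛(p, q)`. -/
def fockOp {p q : P} (a : L.Hom p q) : Adjointable K.Coeff K.Fock := blockOp K Set.univ a

/-- The operator `⨁ T_{p,q}^{w,t}(a)` over `t ∈ P` and `w ∈ pP ∩ qP` with `p⁻¹w = q⁻¹w`, that is,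
over the `w` of the form `w = pu = qu`. -/
def transOp {p q : P} (a : L.Hom p q) : Adjointable K.Coeff K.Fock :=
  blockOp K {u | p * u = q * u} a

theorem fockOp_apply_of_eq {p q : P} (a : L.Hom p q) (x : K.Fock) {u i k t : P} (hi : p * u = i)
    (hk : q * u = k) : ((fockOp K a).1 x).1 (i, t) = K.lmul (L.tensor u hi hk a) (x.1 (k, t)) :=
  blockFun_of_mem K a x.1 (Set.mem_univ u) hi hk

theorem fockOp_apply_of_ne {p q : P} (a : L.Hom p q) (x : K.Fock) {i t : P}
    (h : ¬ ∃ u, p * u = i) : ((fockOp K a).1 x).1 (i, t) = 0 :=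
  blockFun_of_notMem K a x.1 fun ⟨u, _, hu⟩ => h ⟨u, hu⟩

/-- The Fock representation `T` of `K` on the Fock module. -/
def fockRep : K.Representation (Adjointable K.Coeff K.Fock) where
  map {p q} :=
    { toFun := fun a => fockOp K a.1
      map_add' := fun a b => Adjointable.ext' fun x => Subtype.ext <| funext fun i => by
        change ((fockOp K (a.1 + b.1)).1 x).1 (i.1, i.2) =
          ((fockOp K a.1).1 x).1 (i.1, i.2) + ((fockOp K b.1).1 x).1 (i.1, i.2)
        by_cases h : ∃ u, p * u = i.1
        · obtain ⟨u, hu⟩ := h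
          rw [fockOp_apply_of_eq K _ x hu rfl, fockOp_apply_of_eq K _ x hu rfl,
            fockOp_apply_of_eq K _ x hu rfl, L.tensor_add]
          exact Subtype.ext (L.add_comp _ _ _)
        · rw [fockOp_apply_of_ne K _ x h, fockOp_apply_of_ne K _ x h, fockOp_apply_of_ne K _ x h,
            add_zero]
      map_smul' := fun z a => Adjointable.ext' fun x => Subtype.ext <| funext fun i => by
        change ((fockOp K (z • a.1)).1 x).1 (i.1, i.2) = z • ((fockOp K a.1).1 x).1 (i.1, i.2)
        by_cases h : ∃ u, p * u = i.1
        · obtain ⟨u, hu⟩ := h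
          rw [fockOp_apply_of_eq K _ x hu rfl, fockOp_apply_of_eq K _ x hu rfl, L.tensor_smul]
          exact Subtype.ext (L.smul_comp _ _ _)
        · rw [fockOp_apply_of_ne K _ x h, fockOp_apply_of_ne K _ x h, smul_zero] }
  map_adj a := (Adjointable.star_unique (inner_block_left K Set.univ a.1)).symm
  map_comp {p q r} a b := Adjointable.ext' fun x => Subtype.ext <| funext fun i => by
    change ((fockOp K (L.comp a.1 b.1)).1 x).1 (i.1, i.2) =
      ((fockOp K a.1).1 ((fockOp K b.1).1 x)).1 (i.1, i.2)
    by_cases h : ∃ u, p * u = i.1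
    · obtain ⟨u, hu⟩ := h
      rw [fockOp_apply_of_eq K _ _ hu rfl, fockOp_apply_of_eq K _ _ hu rfl,
        fockOp_apply_of_eq K _ _ rfl rfl, L.tensor_comp u hu rfl rfl]
      exact Subtype.ext (L.comp_assoc _ _ _)
    · rw [fockOp_apply_of_ne K _ _ h, fockOp_apply_of_ne K _ _ h]

end Fock

variable (K) in
theorem fockRep_nicaCovariant [IsRightLCM P] : NicaCovariant (fockRep K) := by
  intro p q s t a b
  refine ⟨fun r u v hu hv hr hc => Adjointable.ext' fun x => Subtype.ext <| funext fun i => ?_,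
    fun hr => Adjointable.ext' fun x => Subtype.ext <| funext fun i => ?_⟩
  · change ((fockOp K a.1).1 ((fockOp K b.1).1 x)).1 (i.1, i.2) =
      ((fockOp K (L.comp (L.tensor u rfl hu a.1) (L.tensor v hv rfl b.1))).1 x).1 (i.1, i.2)
    by_cases h : ∃ l, p * u * l = i.1
    · obtain ⟨l, hl⟩ := h
      rw [fockOp_apply_of_eq K _ _ (u := u * l) (k := r * l) (by rw [← mul_assoc, hl])
          (by rw [← mul_assoc, hu]),
        fockOp_apply_of_eq K _ _ (u := v * l) (k := t * v * l) (by rw [← mul_assoc, hv])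
          (by rw [← mul_assoc]),
        fockOp_apply_of_eq K _ _ (u := l) hl rfl, L.tensor_comp l hl rfl rfl,
        L.tensor_tensor, L.tensor_tensor]
      exact Subtype.ext (L.comp_assoc _ _ _).symm
    · rw [fockOp_apply_of_ne K _ _ h]
      by_cases h1 : ∃ k, p * k = i.1
      · obtain ⟨k, hk⟩ := h1
        rw [fockOp_apply_of_eq K _ _ hk rfl, fockOp_apply_of_ne K]
        · exact Subtype.ext (CStarPrecategory.comp_zero _)
        · rintro ⟨m, hm⟩
          have hmem : q * k ∈ rightIdeal q ∩ rightIdeal s := ⟨⟨k, rfl⟩, ⟨m, hm⟩⟩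
          rw [hr] at hmem
          obtain ⟨l, hl⟩ := hmem
          refine h ⟨l, ?_⟩
          have : k = u * l := mul_left_cancel (a := q) (by rw [← mul_assoc, hu]; exact hl.symm)
          rw [← hk, this, mul_assoc]
      · rw [fockOp_apply_of_ne K _ _ h1]
  · change ((fockOp K a.1).1 ((fockOp K b.1).1 x)).1 (i.1, i.2) = 0
    by_cases h1 : ∃ k, p * k = i.1
    · obtain ⟨k, hk⟩ := h1
      rw [fockOp_apply_of_eq K _ _ hk rfl, fockOp_apply_of_ne K]
      · exact Subtype.ext (CStarPrecategory.comp_zero _)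
      · rintro ⟨m, hm⟩
        rcases IsRightLCM.inter q s with h0 | h0
        · have hmem : q * k ∈ rightIdeal q ∩ rightIdeal s := ⟨⟨k, rfl⟩, ⟨m, hm⟩⟩
          rw [h0] at hmem
          exact hmem
        · exact hr h0
    · rw [fockOp_apply_of_ne K _ _ h1]

section Universal

variable (K)

/-- A Nica covariant representation of `K` together with its target `C*`-algebra. -/
structure NicaRep where
  B : Type max u v
  [nonUnitalCStarAlgebra : NonUnitalCStarAlgebra B]
  rep : K.Representation B
  nicaCovariant : NicaCovariant rep

attribute [instance] NicaRep.nonUnitalCStarAlgebra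

/-- The product `∏ B_Φ` over all Nica covariant representations `Φ : K → B_Φ`. -/
abbrev NicaProd : Type _ := lp (fun ρ : NicaRep K => ρ.B) ∞

variable {K} in
/-- The family `(Φ(a))_Φ`. -/
def nicaUniv {p q : P} (a : K.carrier p q) : NicaProd K :=
  ⟨fun ρ => ρ.rep.map a, memℓp_infty ⟨‖a‖, by
    rintro _ ⟨ρ, rfl⟩
    exact ρ.rep.norm_map_le a⟩⟩

/-- The Nica-Toeplitz algebra `𝓝𝓣_𝓛(K)`, constructed as the `C*`-algebra generated by the direct sum
`i_K` of all Nica covariant representations. -/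
def nicaToeplitz : NonUnitalStarSubalgebra ℂ (NicaProd K) :=
  (NonUnitalStarAlgebra.adjoin ℂ
    {b | ∃ p q, ∃ a : K.carrier p q, b = nicaUniv a}).topologicalClosure

instance : IsClosed (nicaToeplitz K : Set (NicaProd K)) :=
  NonUnitalStarSubalgebra.isClosed_topologicalClosure _

variable {K}

/-- The element `i_K(a)` of the Nica-Toeplitz algebra. -/
def toNicaToeplitz {p q : P} (a : K.carrier p q) : nicaToeplitz K :=
  ⟨nicaUniv a, NonUnitalStarSubalgebra.le_topologicalClosure _
    (NonUnitalStarAlgebra.subset_adjoin _ _ ⟨p, q, a, rfl⟩)⟩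

/-- The coordinate projection of the product. -/
def evalHom (ρ : NicaRep K) : NicaProd K →⋆ₙₐ[ℂ] ρ.B where
  toFun f := f.1 ρ
  map_smul' _ _ := rfl
  map_zero' := rfl
  map_add' _ _ := rfl
  map_mul' _ _ := rfl
  map_star' _ := rfl

theorem evalHom_mem (ρ : NicaRep K) (z : nicaToeplitz K) : evalHom ρ z.1 ∈ ρ.rep.algebra := by
  have h : nicaToeplitz K ≤ ρ.rep.algebra.comap (evalHom ρ) := by
    refine NonUnitalStarSubalgebra.topologicalClosure_minimal _
      (NonUnitalStarAlgebra.adjoin_le ?_) ?_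
    · rintro _ ⟨p, q, a, rfl⟩
      exact (ρ.rep.toAlgebra a).2
    · have hc : IsClosed (ρ.rep.algebra : Set ρ.B) := inferInstance
      exact hc.preimage (lp.lipschitzWith_one_eval (E := fun ρ : NicaRep K => ρ.B) ∞ ρ).continuous
  exact h z.2

variable {B : Type max u v} [NonUnitalCStarAlgebra B]

/-- The homomorphism `Φ ⋊ P : 𝓝𝓣_𝓛(K) → C*(Φ(K))` with `(Φ ⋊ P)(i_K(a)) = Φ(a)`. -/
def cross (Φ : K.Representation B) (hΦ : NicaCovariant Φ) : nicaToeplitz K →⋆ₙₐ[ℂ] Φ.algebra :=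
  NonUnitalStarAlgHom.codRestrict
    ((evalHom (⟨B, Φ, hΦ⟩ : NicaRep K)).comp
      (NonUnitalStarSubalgebraClass.subtype (nicaToeplitz K)))
    Φ.algebra (evalHom_mem (⟨B, Φ, hΦ⟩ : NicaRep K))

theorem cross_toNicaToeplitz (Φ : K.Representation B) (hΦ : NicaCovariant Φ) {p q : P}
    (a : K.carrier p q) : cross Φ hΦ (toNicaToeplitz a) = Φ.toAlgebra a := rfl

end Universal

section Exotic

variable [IsRightLCM P]

variable (K) in
/-- The reduced Nica-Toeplitz algebra `C*(T(K))`. -/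
abbrev reducedNicaToeplitz : NonUnitalStarSubalgebra ℂ (Adjointable K.Coeff K.Fock) :=
  (fockRep K).algebra

variable (K) in
/-- The regular representation `T ⋊ P`. -/
def regularRep : nicaToeplitz K →⋆ₙₐ[ℂ] reducedNicaToeplitz K :=
  cross (fockRep K) (fockRep_nicaCovariant K)

/-- `Φ` generates an exotic Nica-Toeplitz algebra: `ker (Φ ⋊ P) ⊆ ker (T ⋊ P)`. -/
def GeneratesExotic {B : Type max u v} [NonUnitalCStarAlgebra B] (Φ : K.Representation B)
    (hΦ : NicaCovariant Φ) : Prop :=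
  {z : nicaToeplitz K | cross Φ hΦ z = 0} ⊆ {z | regularRep K z = 0}

variable (K) in
/-- The transcendental core `B_K`: the closed linear span of the operators `transOp a`. -/
def transcendentalCore : Submodule ℂ (Adjointable K.Coeff K.Fock) :=
  (Submodule.span ℂ
    {S | ∃ p q, ∃ a : K.carrier p q, S = transOp K a.1}).topologicalClosure

/-- The operator `transOp a`, `a ∈ K(p, q)`, as an element of the transcendental core. -/
def toCore {p q : P} (a : K.carrier p q) : transcendentalCore K :=
  ⟨transOp K a.1, Submodule.le_topologicalClosure _ (Submodule.subset_span ⟨p, q, a, rfl⟩)⟩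

variable (K) in
/-- The transcendental conditional expectation `E^T(S) = ∑_w Q_w S Q_w` (strong sum), where `Q_w` is
the projection of the Fock module onto `⨁_t X_{w,t}`. -/
def transExpectation (S : reducedNicaToeplitz K) : Adjointable K.Coeff K.Fock :=
  HilbertSum.diagonal Prod.fst S.1

/-- `E : C*(Φ(K)) → B_K` is given by the transcendental formula. -/
def IsTranscendental {B : Type*} [NonUnitalCStarAlgebra B] (Φ : K.Representation B)
    (E : Φ.algebra →L[ℂ] transcendentalCore K) : Prop :=
  ∀ (F : Finset P) (a : ∀ p q : P, K.carrier p q),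
    E (∑ p ∈ F, ∑ q ∈ F, Φ.toAlgebra (a p q)) = ∑ p ∈ F, ∑ q ∈ F, toCore (a p q)

end Exotic

end RightTensorCStarPrecategory

/-- Complete positivity of a map between `C*`-algebras with their canonical order. -/
def IsCompletelyPositive {A₁ A₂ : Type*} [NonUnitalCStarAlgebra A₁] [NonUnitalCStarAlgebra A₂]
    (f : A₁ → A₂) : Prop :=
  letI := CStarAlgebra.spectralOrder A₁
  letI := CStarAlgebra.spectralOrder A₂
  haveI := CStarAlgebra.spectralOrderedRing A₁
  haveI := CStarAlgebra.spectralOrderedRing A₂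
  ∃ φ : CompletelyPositiveMap A₁ A₂, ∀ x, φ x = f x

end NicaToeplitz

end

open NicaToeplitz NicaToeplitz.RightTensorCStarPrecategory

/-!
The idea is that the transcendental formula is the conditional expectation `E^T` seen through `Φ`.
On the generators one has `E^T(T(a)) = ⨁ T_{p,q}^{w,t}(a)` (`diagonal_fockOp`). By Nica covariance
and alignment a product of two generators is a generator or zero, so the linear span of the
generators is dense in `C*(Φ(K))`, and likewise in the universal algebra (`dense_span_toAlgebra`).
Hence any bounded `E` given by the transcendental formula satisfies `E ∘ (Φ ⋊ P) = E^T ∘ (T ⋊ P)`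
(`IsTranscendental.apply_cross`).

If such an `E` exists and `(Φ ⋊ P)(z) = 0`, then `E^T((T ⋊ P)(z* z)) = 0`, and faithfulness of
`E^T` gives `(T ⋊ P)(z) = 0`, so `Φ` generates an exotic algebra. Conversely `Φ ⋊ P` is
surjective, because homomorphisms of `C*`-algebras have closed range (`isClosed_range_starHom`);
so if `Φ` generates an exotic algebra, the regular representation factors through it as `Φ_* ∘ (Φ
⋊ P)`, and `E = E^T ∘ Φ_*` is the required map. The remaining assertions are then properties of
`E^T`.

The expectation `E^T` maps onto the block diagonal. On the `C*`-algebra of block diagonal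
operators the family of compressions `S ↦ (Q_w S Q_w)_w` is an injective homomorphism into `ℓ^∞`
(`compressionHom`), hence isometric and order reflecting. Since `E^T(S)` and `S` have the same
compressions, contractivity of `E^T` is immediate, and complete positivity follows from `Q_w S* R
Q_w = (S Q_w)* (R Q_w)` (`cstarMatrix_map_nonneg_of_factorization`). Faithfulness holds because
`Q_w S* S Q_w = 0` for all `w` forces `S Q_w = 0` for all `w`.
-/

noncomputable section

/-! ### Homomorphisms of `C*`-algebras -/

namespace NicaToeplitz

section StarHom

variable {A B C : Type*} [NonUnitalCStarAlgebra A] [NonUnitalCStarAlgebra B]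
  [NonUnitalCStarAlgebra C]

theorem continuous_starHom (φ : A →⋆ₙₐ[ℂ] B) : Continuous φ :=
  AddMonoidHomClass.continuous_of_bound φ 1 fun a => by
    rw [one_mul]; exact NonUnitalStarAlgHom.norm_apply_le φ a

theorem starHom_star_mul_self (φ : A →⋆ₙₐ[ℂ] B) (a : A) :
    φ (star a * a) = star (φ a) * φ a := by rw [map_mul, map_star]

/-- A homomorphism of `C*`-algebras as a bounded linear map. -/
def starHomL (φ : A →⋆ₙₐ[ℂ] B) : A →L[ℂ] B where
  toFun := φ
  map_add' := map_add φ
  map_smul' := map_smul φ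
  cont := continuous_starHom φ

/-- The value of a homomorphism at a self-adjoint element has a preimage of no larger norm: cut the
spectrum of `a` off at `±‖φ a‖`. -/
theorem exists_map_eq_norm_le_of_isSelfAdjoint (φ : A →⋆ₙₐ[ℂ] B) {a : A}
    (ha : IsSelfAdjoint a) : ∃ a', φ a' = φ a ∧ ‖a'‖ ≤ ‖φ a‖ := by
  set r := ‖φ a‖ with hr
  have hr0 : 0 ≤ r := norm_nonneg _
  let f : ℝ → ℝ := fun t => max (-r) (min t r)
  have hf : Continuous f := by fun_prop
  have hf0 : f 0 = 0 := by simp [f, hr0]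
  refine ⟨cfcₙ f a, ?_, ?_⟩
  -- `f` is the identity on the spectrum of `φ a`, so `φ (f a) = f (φ a) = φ a`
  · rw [NonUnitalStarAlgHomClass.map_cfcₙ (S := ℂ) φ f a hf.continuousOn hf0 (continuous_starHom φ)
      ha (ha.map φ)]
    conv_rhs => rw [← cfcₙ_id' ℝ (φ a) (ha.map φ)]
    refine cfcₙ_congr fun t ht => ?_
    have h := NonUnitalIsometricContinuousFunctionalCalculus.norm_quasispectrum_le (φ a) ht
      (ha.map φ)
    rw [Real.norm_eq_abs, abs_le] at h
    simp only [f]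
    rw [min_eq_left h.2, max_eq_right h.1]
  · refine norm_cfcₙ_le fun t _ => ?_
    rw [Real.norm_eq_abs, abs_le]
    exact ⟨le_max_left _ _, max_le (by linarith) (min_le_right _ _)⟩

theorem exists_map_eq_norm_le (φ : A →⋆ₙₐ[ℂ] B) (a : A) :
    ∃ a', φ a' = φ a ∧ ‖a'‖ ≤ 2 * ‖φ a‖ := by
  obtain ⟨x, hx, hx'⟩ := exists_map_eq_norm_le_of_isSelfAdjoint φ (realPart a).2
  obtain ⟨y, hy, hy'⟩ := exists_map_eq_norm_le_of_isSelfAdjoint φ (imaginaryPart a).2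
  have hr : ∀ (r : ℝ) (b : A), φ (r • b) = r • φ b := fun r b => map_smul φ (r : ℂ) b
  have hre : φ (realPart a : A) = (realPart (φ a) : B) := by
    rw [realPart_apply_coe, realPart_apply_coe, hr, map_add, map_star]
  have him : φ (imaginaryPart a : A) = (imaginaryPart (φ a) : B) := by
    rw [imaginaryPart_apply_coe, imaginaryPart_apply_coe, map_smul, hr, map_sub, map_star]
  refine ⟨x + Complex.I • y, ?_, ?_⟩
  · rw [map_add, map_smul, hx, hy, ← map_smul, ← map_add, realPart_add_I_smul_imaginaryPart]
  · have h1 : ‖x‖ ≤ ‖φ a‖ := by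
      rw [hre] at hx'
      exact hx'.trans (realPart.norm_le (φ a))
    have h2 : ‖y‖ ≤ ‖φ a‖ := by
      rw [him] at hy'
      exact hy'.trans (imaginaryPart.norm_le (φ a))
    refine (norm_add_le _ _).trans ?_
    rw [norm_smul, Complex.norm_I, one_mul]
    linarith

/-- Preimages with norm control allow Cauchy sequences in the range to be lifted. -/
theorem isClosed_range_starHom (φ : A →⋆ₙₐ[ℂ] B) : IsClosed (Set.range φ) := by
  let f : NormedAddGroupHom A B :=
    AddMonoidHom.mkNormedAddGroupHom (φ : A →+ B) 1 fun a => by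
      rw [one_mul]; exact NonUnitalStarAlgHom.norm_apply_le φ a
  have h : f.SurjectiveOnWith f.range 2 := by
    rintro _ ⟨a, rfl⟩
    exact exists_map_eq_norm_le φ a
  have h1 := controlled_closure_of_complete two_pos one_pos h
  refine isClosed_of_closure_subset fun b hb => ?_
  obtain ⟨a, ha, -⟩ := h1 b hb
  exact ⟨a, ha⟩

/-- An injective homomorphism reflects positivity, as it maps the negative part of `a` to that of
`φ a`. -/
theorem nonneg_of_map_nonneg [PartialOrder A] [StarOrderedRing A] [PartialOrder B]
    [StarOrderedRing B] (φ : A →⋆ₙₐ[ℂ] B) (hφ : Function.Injective φ) {a : A} (h : 0 ≤ φ a) :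
    0 ≤ a := by
  have hs : IsSelfAdjoint a := hφ (by rw [map_star, h.isSelfAdjoint.star_eq])
  rw [← CFC.negPart_eq_zero_iff a hs]
  refine hφ ?_
  rw [map_zero, ← (CFC.negPart_eq_zero_iff (φ a) h.isSelfAdjoint).2 h, CFC.negPart_def,
    CFC.negPart_def]
  exact NonUnitalStarAlgHomClass.map_cfcₙ (S := ℂ) φ _ a (by fun_prop) (by simp)
    (continuous_starHom φ) hs (hs.map φ)

/-- The homomorphism induced on the target of a surjective homomorphism `φ` by a homomorphism whose
kernel contains the kernel of `φ`. -/
def liftOfSurjective (φ : A →⋆ₙₐ[ℂ] B) (hφ : Function.Surjective φ) (ψ : A →⋆ₙₐ[ℂ] C)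
    (h : ∀ a, φ a = 0 → ψ a = 0) : B →⋆ₙₐ[ℂ] C :=
  have key : ∀ {a a' : A}, φ a = φ a' → ψ a = ψ a' := fun {a a'} e => by
    rw [← sub_eq_zero, ← map_sub]
    exact h _ (by rw [map_sub, e, sub_self])
  have hs := Function.surjInv_eq hφ
  { toFun := fun b => ψ (Function.surjInv hφ b)
    map_smul' := fun z b => by
      rw [MonoidHom.id_apply, ← map_smul]; exact key (by rw [map_smul, hs, hs])
    map_zero' := h _ (hs 0)
    map_add' := fun b c => by rw [← map_add]; exact key (by rw [map_add, hs, hs, hs])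
    map_mul' := fun b c => by rw [← map_mul]; exact key (by rw [map_mul, hs, hs, hs])
    map_star' := fun b => by rw [← map_star]; exact key (by rw [map_star, hs, hs]) }

theorem liftOfSurjective_apply (φ : A →⋆ₙₐ[ℂ] B) (hφ : Function.Surjective φ) (ψ : A →⋆ₙₐ[ℂ] C)
    (h : ∀ a, φ a = 0 → ψ a = 0) (a : A) : liftOfSurjective φ hφ ψ h (φ a) = ψ a := by
  rw [← sub_eq_zero]
  change ψ (Function.surjInv hφ (φ a)) - ψ a = 0
  rw [← map_sub]
  exact h _ (by rw [map_sub, Function.surjInv_eq hφ, sub_self])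

/-- A general statement, to be applied to matrix algebras, where the real structure needed for the
continuous functional calculus is not found by instance search. -/
theorem exists_eq_star_mul_self_of_nonneg [PartialOrder A] [StarOrderedRing A] {a : A}
    (h : 0 ≤ a) : ∃ b, a = star b * b :=
  CStarAlgebra.nonneg_iff_eq_star_mul_self.1 h

open CStarMatrix in
/-- A map `f` is completely positive as soon as, after an injective homomorphism `j`, it has a
factorization `j (f (x* y)) = g(x)* g(y)`; here `f` is followed by a homomorphism `e`. -/
theorem cstarMatrix_map_nonneg_of_factorization {A' D : Type*} [NonUnitalCStarAlgebra A']
    [NonUnitalCStarAlgebra D] [PartialOrder A] [StarOrderedRing A] [PartialOrder A']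
    [StarOrderedRing A'] (f : A → D) (j : D →⋆ₙₐ[ℂ] C) (hj : Function.Injective j) (g : A → C)
    {n : Type*} [Fintype n]
    (h : ∀ x y : n → A, j (f (∑ k, star (x k) * y k)) = ∑ k, star (g (x k)) * g (y k))
    (e : D →⋆ₙₐ[ℂ] A') {M : CStarMatrix n n A} (hM : 0 ≤ M) : 0 ≤ M.map (e ∘ f) := by
  let _ := CStarAlgebra.spectralOrder D
  have := CStarAlgebra.spectralOrderedRing D
  let _ := CStarAlgebra.spectralOrder C
  have := CStarAlgebra.spectralOrderedRing C
  have hD : 0 ≤ (M.map f : CStarMatrix n n D) := by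
    refine nonneg_of_map_nonneg (mapₙₐ j) (CStarMatrix.map_injective hj) ?_
    obtain ⟨N, rfl⟩ := exists_eq_star_mul_self_of_nonneg hM
    have : mapₙₐ j ((star N * N).map f) = star (N.map g) * N.map g := by
      ext i k
      exact h (fun l => N l i) (fun l => N l k)
    rw [this]
    exact star_mul_self_nonneg _
  exact map_nonneg (mapₙₐ e) hD

end StarHom

end NicaToeplitz

/-! ### The conditional expectation onto block diagonal operators -/

namespace NicaToeplitz

namespace HilbertSum

open scoped ENNReal

variable {A : Type*} [NonUnitalCStarAlgebra A] [PartialOrder A] [StarOrderedRing A]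
  {ι : Type*} {E : ι → Type*} [∀ i, NormedAddCommGroup (E i)] [∀ i, NormedSpace ℂ (E i)]
  [∀ i, SMul A (E i)] [∀ i, CStarModule A (E i)] [∀ i, CompleteSpace (E i)]
  {κ : Type*} (π : ι → κ)

theorem diagonal_apply (S : Adjointable A (HilbertSum A E)) (x : HilbertSum A E) (i : ι) :
    ((diagonal π S).1 x).1 i = (S.1 (cut (π ⁻¹' {π i}) x)).1 i := by
  let c : HilbertSum A E →+ E i :=
    { toFun := fun y => y.1 i
      map_zero' := rfl
      map_add' := fun _ _ => rfl }
  have hc : Continuous c := AddMonoidHomClass.continuous_of_bound c 1 fun y => by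
    rw [one_mul]; exact norm_apply_le y i
  have h := (summable_diagonal π S x).hasSum.map c hc
  have h' := hasSum_single (f := c ∘ fun k => cut (π ⁻¹' {k}) (S.1 (cut (π ⁻¹' {k}) x))) (π i)
    fun k hk => cut_apply_notMem _ fun hi => hk (Eq.symm hi)
  refine (h.unique h').trans ?_
  exact cut_apply_mem _ (Set.mem_singleton _)

theorem star_proj (J : Set ι) : star (proj J : Adjointable A (HilbertSum A E)) = proj J :=
  Adjointable.star_ofPair _ _ _ _

theorem proj_mul_proj (J : Set ι) :
    (proj J * proj J : Adjointable A (HilbertSum A E)) = proj J :=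
  Adjointable.ext' fun x => cut_cut J x

variable (A E) in
/-- The `C*`-algebra of operators commuting with the projections onto the fibres of `π`. -/
def diagonalSubalgebra : NonUnitalStarSubalgebra ℂ (Adjointable A (HilbertSum A E)) where
  carrier := {S | ∀ k, proj (π ⁻¹' {k}) * S = S * proj (π ⁻¹' {k})}
  add_mem' hS hR k := by rw [mul_add, add_mul, hS, hR]
  zero_mem' _ := by rw [mul_zero, zero_mul]
  mul_mem' {S R} hS hR k := by rw [← mul_assoc, hS, mul_assoc, hR, mul_assoc]
  smul_mem' z S hS k := by rw [mul_smul_comm, hS, smul_mul_assoc]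
  star_mem' {S} hS k := by
    have h := congrArg star (hS k)
    rw [star_mul, star_mul, star_proj] at h
    exact h.symm

instance : IsClosed (diagonalSubalgebra A E π : Set (Adjointable A (HilbertSum A E))) := by
  have : (diagonalSubalgebra A E π : Set (Adjointable A (HilbertSum A E))) =
      ⋂ k, {S | proj (π ⁻¹' {k}) * S = S * proj (π ⁻¹' {k})} := by
    ext S
    rw [Set.mem_iInter]
    rfl
  rw [this]
  exact isClosed_iInter fun k => isClosed_eq (by fun_prop) (by fun_prop)

theorem norm_proj_le (J : Set ι) : ‖(proj J : Adjointable A (HilbertSum A E))‖ ≤ 1 := by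
  have h := CStarRing.norm_star_mul_self (x := (proj J : Adjointable A (HilbertSum A E)))
  rw [star_proj, proj_mul_proj] at h
  by_contra! h1
  nlinarith

theorem norm_compress_le (J : Set ι) (S : Adjointable A (HilbertSum A E)) :
    ‖proj J * S * proj J‖ ≤ ‖S‖ := by
  refine norm_mul_le_of_le (norm_mul_le_of_le (norm_proj_le J) le_rfl) (norm_proj_le J) |>.trans ?_
  simp

/-- The family `(Q_k S Q_k)_k` of compressions of `S` to the fibres of `π`. -/
def compressions (S : Adjointable A (HilbertSum A E)) :
    lp (fun _ : κ => Adjointable A (HilbertSum A E)) ∞ :=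
  ⟨fun k => proj (π ⁻¹' {k}) * S * proj (π ⁻¹' {k}), memℓp_infty ⟨‖S‖, by
    rintro _ ⟨k, rfl⟩
    exact norm_compress_le _ S⟩⟩

theorem norm_compressions_le (S : Adjointable A (HilbertSum A E)) :
    ‖compressions π S‖ ≤ ‖S‖ :=
  lp.norm_le_of_forall_le (norm_nonneg _) fun _ => norm_compress_le _ S

variable (A E) in
/-- On the operators commuting with the projections, compression is multiplicative. -/
def compressionHom : diagonalSubalgebra A E π →⋆ₙₐ[ℂ]
    lp (fun _ : κ => Adjointable A (HilbertSum A E)) ∞ where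
  toFun S := compressions π S.1
  map_smul' z S := lp.ext <| funext fun k => by
    change proj (π ⁻¹' {k}) * (z • S.1) * proj (π ⁻¹' {k}) =
      z • (proj (π ⁻¹' {k}) * S.1 * proj (π ⁻¹' {k}))
    rw [mul_smul_comm, smul_mul_assoc]
  map_zero' := lp.ext <| funext fun k => by
    change proj (π ⁻¹' {k}) * 0 * proj (π ⁻¹' {k}) = 0
    rw [mul_zero, zero_mul]
  map_add' S R := lp.ext <| funext fun k => by
    change proj (π ⁻¹' {k}) * (S.1 + R.1) * proj (π ⁻¹' {k}) =
      proj (π ⁻¹' {k}) * S.1 * proj (π ⁻¹' {k}) + proj (π ⁻¹' {k}) * R.1 * proj (π ⁻¹' {k})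
    rw [mul_add, add_mul]
  map_mul' S R := lp.ext <| funext fun k => by
    change proj (π ⁻¹' {k}) * (S.1 * R.1) * proj (π ⁻¹' {k}) =
      proj (π ⁻¹' {k}) * S.1 * proj (π ⁻¹' {k}) * (proj (π ⁻¹' {k}) * R.1 * proj (π ⁻¹' {k}))
    have h := S.2 k
    calc _ = proj (π ⁻¹' {k}) * S.1 * R.1 * proj (π ⁻¹' {k}) := by rw [mul_assoc (proj _) S.1]
      _ = proj (π ⁻¹' {k}) * proj (π ⁻¹' {k}) * S.1 * R.1 * proj (π ⁻¹' {k}) := by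
        rw [proj_mul_proj]
      _ = proj (π ⁻¹' {k}) * (S.1 * proj (π ⁻¹' {k})) * R.1 * proj (π ⁻¹' {k}) := by
        rw [mul_assoc (proj _) (proj _) S.1, h]
      _ = proj (π ⁻¹' {k}) * (S.1 * (proj (π ⁻¹' {k}) * proj (π ⁻¹' {k}))) * R.1 *
          proj (π ⁻¹' {k}) := by rw [proj_mul_proj]
      _ = _ := by simp only [mul_assoc]
  map_star' S := lp.ext <| funext fun k => by
    change proj (π ⁻¹' {k}) * star S.1 * proj (π ⁻¹' {k}) =
      star (proj (π ⁻¹' {k}) * S.1 * proj (π ⁻¹' {k}))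
    rw [star_mul, star_mul, star_proj, mul_assoc]

theorem compressionHom_injective : Function.Injective (compressionHom A E π) := by
  rw [injective_iff_map_eq_zero]
  intro S hS
  refine Subtype.ext (Adjointable.ext' fun x => Subtype.ext (funext fun i => ?_))
  have h : proj (π ⁻¹' {π i}) * S.1 * proj (π ⁻¹' {π i}) = 0 :=
    congrFun (congrArg Subtype.val hS) (π i)
  have h2 : proj (π ⁻¹' {π i}) * S.1 = 0 := by
    rw [← proj_mul_proj, mul_assoc, S.2 (π i), ← mul_assoc, h]
  have h3 : (cut (π ⁻¹' {π i}) (S.1.1 x)).1 i = 0 :=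
    congrFun (congrArg Subtype.val (DFunLike.congr_fun (congrArg Subtype.val h2) x)) i
  exact (cut_apply_mem (J := π ⁻¹' {π i}) _ (Set.mem_singleton (π i))).symm.trans h3

theorem diagonal_mem (S : Adjointable A (HilbertSum A E)) :
    diagonal π S ∈ diagonalSubalgebra A E π := by
  intro k
  refine Adjointable.ext' fun x => Subtype.ext (funext fun i => ?_)
  change (cut (π ⁻¹' {k}) ((diagonal π S).1 x)).1 i =
    ((diagonal π S).1 (cut (π ⁻¹' {k}) x)).1 i
  rw [diagonal_apply]
  by_cases h : i ∈ π ⁻¹' {k}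
  · have hk : π i = k := h
    subst hk
    rw [cut_apply_mem _ h, diagonal_apply, cut_cut]
  · rw [cut_apply_notMem _ h]
    have : cut (π ⁻¹' {π i}) (cut (π ⁻¹' {k}) x) = 0 := by
      refine Subtype.ext (funext fun j => ?_)
      by_cases hj : j ∈ π ⁻¹' {π i}
      · rw [cut_apply_mem _ hj, cut_apply_notMem]
        · rfl
        · exact fun hk => h (Eq.trans (Eq.symm hj) hk)
      · rw [cut_apply_notMem _ hj]; rfl
    rw [this, map_zero]
    rfl

theorem compressions_diagonal (S : Adjointable A (HilbertSum A E)) :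
    compressions π (diagonal π S) = compressions π S := by
  refine lp.ext <| funext fun k => Adjointable.ext' fun x => Subtype.ext (funext fun i => ?_)
  change (cut (π ⁻¹' {k}) ((diagonal π S).1 (cut (π ⁻¹' {k}) x))).1 i =
    (cut (π ⁻¹' {k}) (S.1 (cut (π ⁻¹' {k}) x))).1 i
  by_cases h : i ∈ π ⁻¹' {k}
  · have hk : π i = k := h
    subst hk
    rw [cut_apply_mem _ h, cut_apply_mem _ h, diagonal_apply, cut_cut]
  · rw [cut_apply_notMem _ h, cut_apply_notMem _ h]

theorem norm_diagonal_le (S : Adjointable A (HilbertSum A E)) : ‖diagonal π S‖ ≤ ‖S‖ := by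
  have h := NonUnitalStarAlgHom.norm_map (compressionHom A E π) (compressionHom_injective π)
    ⟨diagonal π S, diagonal_mem π S⟩
  calc ‖diagonal π S‖ = ‖compressions π (diagonal π S)‖ := h.symm
    _ ≤ ‖S‖ := by rw [compressions_diagonal]; exact norm_compressions_le π S

/-- The conditional expectation onto the block diagonal is faithful. -/
theorem diagonal_star_mul_self_eq_zero {S : Adjointable A (HilbertSum A E)}
    (h : diagonal π (star S * S) = 0) : S = 0 := by
  have h1 : ∀ k, S * proj (π ⁻¹' {k}) = 0 := fun k => by
    have h2 : proj (π ⁻¹' {k}) * (star S * S) * proj (π ⁻¹' {k}) = 0 := by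
      have h3 := congrFun (congrArg Subtype.val (compressions_diagonal π (star S * S))) k
      rw [h] at h3
      refine Eq.trans h3.symm ?_
      change proj (π ⁻¹' {k}) * 0 * proj (π ⁻¹' {k}) = 0
      rw [mul_zero, zero_mul]
    rw [← CStarRing.star_mul_self_eq_zero_iff, star_mul, star_proj, ← h2]
    simp only [mul_assoc]
  rw [← star_eq_zero]
  refine Adjointable.ext' fun x => Subtype.ext (funext fun i => ?_)
  have h2 : proj (π ⁻¹' {π i}) * star S = 0 := by
    rw [← star_proj, ← star_mul, h1, star_zero]
  have h3 : (cut (π ⁻¹' {π i}) ((star S).1 x)).1 i = 0 :=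
    congrFun (congrArg Subtype.val (DFunLike.congr_fun (congrArg Subtype.val h2) x)) i
  exact (cut_apply_mem (J := π ⁻¹' {π i}) _ (Set.mem_singleton (π i))).symm.trans h3

variable (A E) in
/-- The conditional expectation `diagonal` as a bounded linear map. -/
def diagonalL : Adjointable A (HilbertSum A E) →L[ℂ] Adjointable A (HilbertSum A E) :=
  LinearMap.mkContinuous
    { toFun := diagonal π
      map_add' := fun S R => Adjointable.ext' fun x => Subtype.ext (funext fun i => by
        change ((diagonal π (S + R)).1 x).1 i =
          ((diagonal π S).1 x).1 i + ((diagonal π R).1 x).1 i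
        rw [diagonal_apply, diagonal_apply, diagonal_apply]
        rfl)
      map_smul' := fun z S => Adjointable.ext' fun x => Subtype.ext (funext fun i => by
        change ((diagonal π (z • S)).1 x).1 i = z • ((diagonal π S).1 x).1 i
        rw [diagonal_apply, diagonal_apply]
        rfl) } 1 fun S => by rw [one_mul]; exact norm_diagonal_le π S

theorem compressions_sum_star_mul {n : Type*} [Fintype n]
    (x y : n → Adjointable A (HilbertSum A E)) (w : κ) :
    (compressions π (∑ k, star (x k) * y k)).1 w =
      ∑ k, star (x k * proj (π ⁻¹' {w})) * (y k * proj (π ⁻¹' {w})) := by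
  change proj (π ⁻¹' {w}) * (∑ k, star (x k) * y k) * proj (π ⁻¹' {w}) = _
  rw [Finset.mul_sum, Finset.sum_mul]
  refine Finset.sum_congr rfl fun k _ => ?_
  rw [star_mul, star_proj]
  simp only [mul_assoc]

/-- The family `(S Q_k)_k`, where `Q_k` is the projection onto the fibre of `π` over `k`. -/
def rightCompressions (S : Adjointable A (HilbertSum A E)) :
    lp (fun _ : κ => Adjointable A (HilbertSum A E)) ∞ :=
  ⟨fun k => S * proj (π ⁻¹' {k}), memℓp_infty ⟨‖S‖, by
    rintro _ ⟨k, rfl⟩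
    exact (norm_mul_le_of_le le_rfl (norm_proj_le _)).trans (by simp)⟩⟩

/-- The conditional expectation onto the block diagonal is completely positive, also after a
homomorphism `φ`. -/
theorem cstarMatrix_map_diagonal_nonneg {A' : Type*} [NonUnitalCStarAlgebra A'] [PartialOrder A']
    [StarOrderedRing A'] (φ : A' →⋆ₙₐ[ℂ] Adjointable A (HilbertSum A E))
    [PartialOrder (Adjointable A (HilbertSum A E))]
    [StarOrderedRing (Adjointable A (HilbertSum A E))] {n : Type*} [Fintype n]
    {M : CStarMatrix n n A'} (hM : 0 ≤ M) :
    0 ≤ M.map fun a => diagonal π (φ a) := by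
  refine cstarMatrix_map_nonneg_of_factorization
    (fun a => (⟨diagonal π (φ a), diagonal_mem π _⟩ : diagonalSubalgebra A E π))
    (compressionHom A E π) (compressionHom_injective π) (fun a => rightCompressions π (φ a))
    (fun x y => ?_) (NonUnitalStarSubalgebraClass.subtype (diagonalSubalgebra A E π)) hM
  change compressions π (diagonal π _) = _
  rw [compressions_diagonal, map_sum]
  refine lp.ext <| funext fun w => ?_
  let ev : lp (fun _ : κ => Adjointable A (HilbertSum A E)) ∞ →+ Adjointable A (HilbertSum A E) :=
    { toFun := fun f => f.1 w
      map_zero' := rfl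
      map_add' := fun _ _ => rfl }
  refine Eq.trans ?_ (map_sum ev _ _).symm
  simp only [map_mul, map_star]
  exact compressions_sum_star_mul π _ _ w

end HilbertSum

end NicaToeplitz

/-! ### Generators of `C*(Φ(K))` and the expectation on the Fock module -/

namespace NicaToeplitz

open scoped ENNReal

namespace RightTensorCStarPrecategory

variable {P : Type u} [Monoid P] {L : RightTensorCStarPrecategory.{u, v} P}
  {K : L.toCStarPrecategory.Ideal}

section Density

variable {B : Type*} [NonUnitalCStarAlgebra B] {Φ : K.Representation B}

/-- Products of generators are generators or zero, so no products are needed to generate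
`C*(Φ(K))`: the linear span of the ranges of `Φ` is already dense. -/
theorem algebra_subset_closure_span (hK : L.WellAligned K) (hΦ : NicaCovariant Φ) :
    (Φ.algebra : Set B) ⊆
      closure (Submodule.span ℂ {b | ∃ p q, ∃ a : K.carrier p q, b = Φ.map a}) := by
  refine closure_mono fun b hb => ?_
  rw [SetLike.mem_coe] at hb ⊢
  induction hb using NonUnitalStarAlgebra.adjoin_induction with
  | mem x hx => exact Submodule.subset_span hx
  | add x y _ _ hx hy => exact add_mem hx hy
  | zero => exact zero_mem _
  | smul r x _ hx => exact Submodule.smul_mem _ r hx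
  | star x hx' hx =>
    clear hx'
    induction hx using Submodule.span_induction with
    | mem x hx =>
      obtain ⟨p, q, a, rfl⟩ := hx
      exact Submodule.subset_span ⟨q, p, _, (Φ.map_adj a).symm⟩
    | zero => rw [star_zero]; exact zero_mem _
    | add x y _ _ hx hy => rw [star_add]; exact add_mem hx hy
    | smul r x _ hx => rw [star_smul]; exact Submodule.smul_mem _ _ hx
  | mul x y hx' hy' hx hy =>
    clear hx' hy'
    induction hx, hy using Submodule.span_induction₂ with
    | mem_mem x y hx hy =>
      obtain ⟨p, q, a, rfl⟩ := hx
      obtain ⟨s, t, b, rfl⟩ := hy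
      by_cases h : ∃ r, rightIdeal q ∩ rightIdeal s = rightIdeal r
      · obtain ⟨r, hr⟩ := h
        have hmem : r ∈ rightIdeal q ∩ rightIdeal s := hr ▸ ⟨1, mul_one r⟩
        obtain ⟨⟨u, hu⟩, v, hv⟩ := hmem
        rw [(hΦ p q s t a b).1 r u v hu hv hr (hK.comp_mem hu hv hr a.2 b.2)]
        exact Submodule.subset_span ⟨_, _, _, rfl⟩
      · rw [(hΦ p q s t a b).2 h]
        exact zero_mem _
    | zero_left y _ => rw [zero_mul]; exact zero_mem _
    | zero_right x _ => rw [mul_zero]; exact zero_mem _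
    | add_left x y z _ _ _ h1 h2 => rw [add_mul]; exact add_mem h1 h2
    | add_right x y z _ _ _ h1 h2 => rw [mul_add]; exact add_mem h1 h2
    | smul_left r x y _ _ h => rw [smul_mul_assoc]; exact Submodule.smul_mem _ _ h
    | smul_right r x y _ _ h => rw [mul_smul_comm]; exact Submodule.smul_mem _ _ h

theorem dense_span_toAlgebra (hK : L.WellAligned K) (hΦ : NicaCovariant Φ) :
    Dense (Submodule.span ℂ {b : Φ.algebra | ∃ p q, ∃ a : K.carrier p q, b = Φ.toAlgebra a} :
      Set Φ.algebra) := by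
  intro b
  rw [closure_subtype]
  refine closure_mono ?_ (algebra_subset_closure_span hK hΦ b.2)
  intro x hx
  rw [SetLike.mem_coe] at hx
  induction hx using Submodule.span_induction with
  | mem x hx =>
    obtain ⟨p, q, a, rfl⟩ := hx
    exact ⟨_, Submodule.subset_span ⟨p, q, a, rfl⟩, rfl⟩
  | zero => exact ⟨0, zero_mem _, rfl⟩
  | add x y _ _ hx hy =>
    obtain ⟨x, hx, rfl⟩ := hx
    obtain ⟨y, hy, rfl⟩ := hy
    exact ⟨x + y, add_mem hx hy, rfl⟩
  | smul r x _ hx =>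
    obtain ⟨x, hx, rfl⟩ := hx
    exact ⟨r • x, Submodule.smul_mem _ r hx, rfl⟩

/-- Continuous linear maps agreeing on generators of `C*(Φ(K))` agree. -/
theorem clm_ext_toAlgebra (hK : L.WellAligned K) (hΦ : NicaCovariant Φ) {F : Type*}
    [NormedAddCommGroup F] [NormedSpace ℂ F] {S T : Φ.algebra →L[ℂ] F}
    (h : ∀ {p q : P} (a : K.carrier p q), S (Φ.toAlgebra a) = T (Φ.toAlgebra a)) : S = T :=
  ContinuousLinearMap.ext_on (dense_span_toAlgebra hK hΦ) (by
    rintro _ ⟨p, q, a, rfl⟩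
    exact h a)

end Density

variable (K) in
/-- The universal Nica covariant representation `i_K`. -/
def univRep : K.Representation (NicaProd K) where
  map {_ _} :=
    { toFun := nicaUniv
      map_add' := fun a b => lp.ext <| funext fun ρ => ρ.rep.map.map_add a b
      map_smul' := fun z a => lp.ext <| funext fun ρ => ρ.rep.map.map_smul z a }
  map_adj a := lp.ext <| funext fun ρ => ρ.rep.map_adj a
  map_comp a b := lp.ext <| funext fun ρ => ρ.rep.map_comp a b

variable (K) in
theorem univRep_nicaCovariant : NicaCovariant (univRep K) := fun p q s t a b =>
  ⟨fun r u v hu hv hr hc => lp.ext <| funext fun ρ =>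
    (ρ.nicaCovariant p q s t a b).1 r u v hu hv hr hc,
  fun h => lp.ext <| funext fun ρ => (ρ.nicaCovariant p q s t a b).2 h⟩

/-- Continuous linear maps agreeing on the elements `i_K(a)` agree. -/
theorem clm_ext_toNicaToeplitz (hK : L.WellAligned K) {F : Type*}
    [NormedAddCommGroup F] [NormedSpace ℂ F] {S T : nicaToeplitz K →L[ℂ] F}
    (h : ∀ {p q : P} (a : K.carrier p q), S (toNicaToeplitz a) = T (toNicaToeplitz a)) : S = T :=
  clm_ext_toAlgebra (Φ := univRep K) hK (univRep_nicaCovariant K) h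

/-- The range of `Φ ⋊ P` is closed and contains the generators. -/
theorem cross_surjective {B : Type max u v} [NonUnitalCStarAlgebra B] (Φ : K.Representation B)
    (hΦ : NicaCovariant Φ) : Function.Surjective (cross Φ hΦ) := by
  let R : NonUnitalStarSubalgebra ℂ B :=
    NonUnitalStarAlgHom.range
      ((NonUnitalStarSubalgebraClass.subtype Φ.algebra).comp (cross Φ hΦ))
  have hR : IsClosed (R : Set B) := by
    have := isClosed_range_starHom
      ((NonUnitalStarSubalgebraClass.subtype Φ.algebra).comp (cross Φ hΦ))
    exact this
  have h : Φ.algebra ≤ R := by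
    refine NonUnitalStarSubalgebra.topologicalClosure_minimal _
      (NonUnitalStarAlgebra.adjoin_le ?_) hR
    rintro _ ⟨p, q, a, rfl⟩
    exact ⟨toNicaToeplitz a, rfl⟩
  intro b
  obtain ⟨z, hz⟩ := h b.2
  exact ⟨z, Subtype.ext hz⟩

section Expectation

variable [IsRightLCM P]

/-- `E^T(T(a)) = ⨁ T_{p,q}^{w,t}(a)` over `w ∈ pP ∩ qP` with `p⁻¹w = q⁻¹w`. -/
theorem diagonal_fockOp {p q : P} (a : L.Hom p q) :
    HilbertSum.diagonal Prod.fst (fockOp K a) = transOp K a := by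
  refine Adjointable.ext' fun x => Subtype.ext (funext fun i => ?_)
  rw [HilbertSum.diagonal_apply]
  by_cases h : ∃ u, p * u = i.1
  · obtain ⟨u, hu⟩ := h
    refine (fockOp_apply_of_eq K a _ (t := i.2) hu rfl).trans ?_
    by_cases hq : p * u = q * u
    · refine Eq.trans ?_ (blockFun_of_mem K a x.1 (C := {u | p * u = q * u}) hq hu rfl).symm
      rw [HilbertSum.cut_apply_mem]
      exact hq.symm.trans hu
    · refine Eq.trans ?_ (blockFun_of_notMem K a x.1 ?_).symm
      · rw [HilbertSum.cut_apply_notMem]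
        · exact Subtype.ext (CStarPrecategory.comp_zero _)
        · exact fun h => hq (hu.trans (Eq.symm h))
      · rintro ⟨w, hw, hw'⟩
        obtain rfl : w = u := mul_left_cancel (hw'.trans hu.symm)
        exact hq hw
  · refine (fockOp_apply_of_ne K a _ (t := i.2) h).trans ?_
    exact (blockFun_of_notMem K a x.1 fun ⟨u, _, hu⟩ => h ⟨u, hu⟩).symm

/-- By linearity the transcendental formula need only be checked on single generators. -/
theorem isTranscendental_iff {B : Type*} [NonUnitalCStarAlgebra B] (Φ : K.Representation B)
    (E : Φ.algebra →L[ℂ] transcendentalCore K) :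
    IsTranscendental Φ E ↔
      ∀ {p q : P} (a : K.carrier p q), E (Φ.toAlgebra a) = toCore a := by
  classical
  constructor
  · intro h p q a
    have h0 : ∀ p q : P, Φ.toAlgebra (0 : K.carrier p q) = 0 := fun p q =>
      Subtype.ext Φ.map.map_zero
    have h1 : ∀ p q : P, toCore (0 : K.carrier p q) = 0 := fun p q => by
      refine Subtype.ext ?_
      change transOp K 0 = 0
      rw [← diagonal_fockOp]
      have : fockOp K (0 : L.Hom p q) = 0 := (fockRep K).map.map_zero
      rw [this]
      exact map_zero (HilbertSum.diagonalL K.Coeff _ Prod.fst)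
    -- the family that is `a` at `(p, q)` and zero elsewhere, summed over `F = {p, q}`
    let f : ∀ p' q' : P, K.carrier p' q' := Pi.single p (Pi.single q a)
    have hf : ∀ p' q', p' ≠ p → f p' q' = 0 := fun p' q' hp => by
      simp only [f, Pi.single_eq_of_ne hp, Pi.zero_apply]
    have hf' : ∀ q', q' ≠ q → f p q' = 0 := fun q' hq => by
      simp only [f, Pi.single_eq_same, Pi.single_eq_of_ne hq]
    have hfa : f p q = a := by simp only [f, Pi.single_eq_same]
    have key := h {p, q} f
    have hp : p ∈ ({p, q} : Finset P) := by simp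
    have hq : q ∈ ({p, q} : Finset P) := by simp
    rw [Finset.sum_eq_single_of_mem p hp fun p' _ hp' =>
        Finset.sum_eq_zero fun q' _ => by rw [hf _ _ hp', h0],
      Finset.sum_eq_single_of_mem q hq fun q' _ hq' => by rw [hf' _ hq', h0],
      Finset.sum_eq_single_of_mem p hp fun p' _ hp' =>
        Finset.sum_eq_zero fun q' _ => by rw [hf _ _ hp', h1],
      Finset.sum_eq_single_of_mem q hq fun q' _ hq' => by rw [hf' _ hq', h1], hfa] at key
    exact key
  · intro h F a
    simp only [map_sum, h]

variable (K) in
/-- The expectation `E^T` as a bounded linear map. -/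
def transExpectationL : reducedNicaToeplitz K →L[ℂ] Adjointable K.Coeff K.Fock :=
  (HilbertSum.diagonalL K.Coeff _ Prod.fst).comp
    (reducedNicaToeplitz K).toSubmodule.subtypeL

theorem transExpectation_mem (hK : L.WellAligned K) (S : reducedNicaToeplitz K) :
    transExpectation K S ∈ transcendentalCore K := by
  have hd := dense_span_toAlgebra hK (fockRep_nicaCovariant K) S
  have hc : IsClosed (transcendentalCore K : Set (Adjointable K.Coeff K.Fock)) :=
    Submodule.isClosed_topologicalClosure _
  refine closure_minimal ?_ (hc.preimage (transExpectationL K).continuous) hd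
  intro T hT
  change T ∈ (transcendentalCore K).comap (transExpectationL K : _ →ₗ[ℂ] _)
  refine Submodule.span_le.2 ?_ hT
  rintro _ ⟨p, q, a, rfl⟩
  change HilbertSum.diagonal Prod.fst (fockOp K a.1) ∈ transcendentalCore K
  rw [diagonal_fockOp]
  exact (toCore a).2

/-- Faithfulness of `E^T`, for values of a homomorphism `φ`. -/
theorem transExpectation_map_star_mul_self_eq_zero_iff {A : Type*} [NonUnitalCStarAlgebra A]
    (φ : A →⋆ₙₐ[ℂ] reducedNicaToeplitz K) (a : A) :
    transExpectation K (φ (star a * a)) = 0 ↔ φ a = 0 := by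
  have h : (φ (star a * a)).1 = star (φ a).1 * (φ a).1 :=
    starHom_star_mul_self
      ((NonUnitalStarSubalgebraClass.subtype (reducedNicaToeplitz K)).comp φ) a
  change HilbertSum.diagonal Prod.fst (φ (star a * a)).1 = 0 ↔ _
  rw [h]
  refine ⟨fun h0 => Subtype.ext (HilbertSum.diagonal_star_mul_self_eq_zero Prod.fst h0),
    fun h0 => ?_⟩
  have h1 : (φ a).1 = 0 := congrArg Subtype.val h0
  rw [h1, mul_zero]
  exact map_zero (HilbertSum.diagonalL K.Coeff _ Prod.fst)

variable {B : Type max u v} [NonUnitalCStarAlgebra B] {Φ : K.Representation B}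
  {hΦ : NicaCovariant Φ}

/-- A bounded map given by the transcendental formula intertwines `Φ ⋊ P` and `E^T ∘ (T ⋊ P)`. -/
theorem IsTranscendental.apply_cross (hK : L.WellAligned K)
    {E : Φ.algebra →L[ℂ] transcendentalCore K} (hE : IsTranscendental Φ E) (z : nicaToeplitz K) :
    (E (cross Φ hΦ z) : Adjointable K.Coeff K.Fock) = transExpectation K (regularRep K z) := by
  rw [isTranscendental_iff] at hE
  let S : nicaToeplitz K →L[ℂ] Adjointable K.Coeff K.Fock :=
    ((transcendentalCore K).subtypeL.comp E).comp
      (starHomL (cross Φ hΦ))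
  let T : nicaToeplitz K →L[ℂ] Adjointable K.Coeff K.Fock :=
    (transExpectationL K).comp
      (starHomL (regularRep K))
  have h : S = T := clm_ext_toNicaToeplitz hK fun a => by
    change (E (Φ.toAlgebra a) : Adjointable K.Coeff K.Fock) =
      HilbertSum.diagonal Prod.fst (fockOp K a.1)
    rw [hE, diagonal_fockOp]
    rfl
  exact DFunLike.congr_fun h z

theorem IsTranscendental.generatesExotic (hK : L.WellAligned K)
    {E : Φ.algebra →L[ℂ] transcendentalCore K} (hE : IsTranscendental Φ E) :
    GeneratesExotic Φ hΦ := by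
  intro z hz
  rw [Set.mem_ofPred_eq] at hz ⊢
  rw [← transExpectation_map_star_mul_self_eq_zero_iff, ← hE.apply_cross hK (hΦ := hΦ), map_mul,
    hz, mul_zero, map_zero]
  rfl

theorem GeneratesExotic.exists_isTranscendental (hK : L.WellAligned K)
    (h : GeneratesExotic Φ hΦ) :
    ∃ E : Φ.algebra →L[ℂ] transcendentalCore K, IsTranscendental Φ E := by
  let ψ := liftOfSurjective (cross Φ hΦ) (cross_surjective Φ hΦ) (regularRep K) fun z hz => h hz
  have hψ := liftOfSurjective_apply (cross Φ hΦ) (cross_surjective Φ hΦ) (regularRep K)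
    fun z hz => h hz
  refine ⟨((transExpectationL K).comp (starHomL ψ)).codRestrict
      (transcendentalCore K) fun b => transExpectation_mem hK _, ?_⟩
  rw [isTranscendental_iff]
  intro p q a
  refine Subtype.ext ?_
  change transExpectation K (ψ (cross Φ hΦ (toNicaToeplitz a))) = transOp K a.1
  rw [hψ, ← diagonal_fockOp]
  rfl

theorem isCompletelyPositive_of_eq_transExpectation
    {E : Φ.algebra →L[ℂ] transcendentalCore K} (Φs : Φ.algebra →⋆ₙₐ[ℂ] reducedNicaToeplitz K)
    (hE : ∀ c, (E c : Adjointable K.Coeff K.Fock) = transExpectation K (Φs c)) :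
    IsCompletelyPositive (fun c => (E c : Adjointable K.Coeff K.Fock)) := by
  let _ := CStarAlgebra.spectralOrder Φ.algebra
  let _ := CStarAlgebra.spectralOrder (Adjointable K.Coeff K.Fock)
  have := CStarAlgebra.spectralOrderedRing Φ.algebra
  have := CStarAlgebra.spectralOrderedRing (Adjointable K.Coeff K.Fock)
  let φ : Φ.algebra →⋆ₙₐ[ℂ] Adjointable K.Coeff K.Fock :=
    (NonUnitalStarSubalgebraClass.subtype (reducedNicaToeplitz K)).comp Φs
  let e : Φ.algebra →ₗ[ℂ] Adjointable K.Coeff K.Fock :=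
    (transcendentalCore K).subtype ∘ₗ (E : Φ.algebra →ₗ[ℂ] transcendentalCore K)
  have he : ⇑e = fun c => HilbertSum.diagonal Prod.fst (φ c) := funext hE
  refine ⟨⟨e, fun k M hM => ?_⟩, fun c => rfl⟩
  rw [he]
  exact HilbertSum.cstarMatrix_map_diagonal_nonneg Prod.fst φ hM

theorem bijective_iff_of_eq_transExpectation {E : Φ.algebra →L[ℂ] transcendentalCore K}
    (Φs : Φ.algebra →⋆ₙₐ[ℂ] reducedNicaToeplitz K)
    (hs : ∀ z, Φs (cross Φ hΦ z) = regularRep K z)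
    (hE : ∀ c, (E c : Adjointable K.Coeff K.Fock) = transExpectation K (Φs c)) :
    Function.Bijective Φs ↔ ∀ c, E (star c * c) = 0 → c = 0 := by
  have hz : ∀ c, E (star c * c) = 0 ↔ Φs c = 0 := fun c => by
    refine Iff.trans ?_ (transExpectation_map_star_mul_self_eq_zero_iff Φs c)
    rw [← hE]
    exact Subtype.ext_iff
  have hΦs : Function.Surjective Φs := fun S => by
    obtain ⟨z, rfl⟩ := cross_surjective (fockRep K) (fockRep_nicaCovariant K) S
    exact ⟨cross Φ hΦ z, hs z⟩
  refine ⟨fun h c hc => h.1 (((hz c).1 hc).trans (map_zero Φs).symm), fun h =>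
    ⟨fun c d hcd => sub_eq_zero.1 (h _ ((hz _).2 ?_)), hΦs⟩⟩
  exact (map_sub Φs c d).trans (sub_eq_zero.2 hcd)

end Expectation

end RightTensorCStarPrecategory

end NicaToeplitz

end

theorem mainTheorem6 {P : Type u} [Monoid P] [IsRightLCM P]
    (L : RightTensorCStarPrecategory.{u, v} P) (K : L.toCStarPrecategory.Ideal)
    (hK : L.WellAligned K) {B : Type max u v} [NonUnitalCStarAlgebra B]
    (Φ : K.Representation B) (hΦ : NicaCovariant Φ) :
    (GeneratesExotic Φ hΦ ↔
      ∃ E : Φ.algebra →L[ℂ] transcendentalCore K, IsTranscendental Φ E) ∧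
    ∀ E : Φ.algebra →L[ℂ] transcendentalCore K, IsTranscendental Φ E →
      (∃! Φs : Φ.algebra →⋆ₙₐ[ℂ] reducedNicaToeplitz K,
        ∀ z, Φs (cross Φ hΦ z) = regularRep K z) ∧
      ∀ Φs : Φ.algebra →⋆ₙₐ[ℂ] reducedNicaToeplitz K,
        (∀ z, Φs (cross Φ hΦ z) = regularRep K z) →
        ‖E‖ ≤ 1 ∧
        IsCompletelyPositive (fun c => (E c : Adjointable K.Coeff K.Fock)) ∧
        (∀ c, (E c : Adjointable K.Coeff K.Fock) = transExpectation K (Φs c)) ∧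
        (Function.Bijective Φs ↔ ∀ c, E (star c * c) = 0 → c = 0) := by
  have hsurj := cross_surjective Φ hΦ
  refine ⟨⟨fun h => h.exists_isTranscendental hK, fun ⟨E, hE⟩ => hE.generatesExotic hK⟩,
    fun E hE => ⟨?_, fun Φs hs => ?_⟩⟩
  · have h : GeneratesExotic Φ hΦ := hE.generatesExotic hK
    refine ⟨liftOfSurjective (cross Φ hΦ) hsurj (regularRep K) fun z hz => h hz,
      liftOfSurjective_apply _ _ _ _, fun ψ hψ => ?_⟩
    refine DFunLike.ext _ _ fun b => ?_
    obtain ⟨z, rfl⟩ := hsurj b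
    rw [hψ, liftOfSurjective_apply]
  · have hEs : ∀ c, (E c : Adjointable K.Coeff K.Fock) = transExpectation K (Φs c) := fun c => by
      obtain ⟨z, rfl⟩ := hsurj c
      rw [hE.apply_cross hK, hs]
    refine ⟨?_, ?_, hEs, ?_⟩
    · refine ContinuousLinearMap.opNorm_le_bound _ zero_le_one fun c => ?_
      rw [one_mul]
      change ‖(E c : Adjointable K.Coeff K.Fock)‖ ≤ _
      rw [hEs]
      exact (HilbertSum.norm_diagonal_le Prod.fst (Φs c).1).trans
        (NonUnitalStarAlgHom.norm_apply_le Φs c)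
    · exact isCompletelyPositive_of_eq_transExpectation Φs hEs
    · exact bijective_iff_of_eq_transExpectation Φs hs hEs
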